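/- Let $\pi=(\pi^{ij})$ be a smooth Poisson tensor on $M=\mathbb{R}^d$ with $\pi^{ij}=\{x^i,x^j\}$, and let $H\in C^\infty(M)$. Write $(x,p)$ for the canonical coordinates of $T^*M=\mathbb{R}^d\times\mathbb{R}^d$. **Karasev map.** Let $\overline V(x,p)=-\pi^{ij}(x)p_i\,\partial_{x^j}$ be the flat Poisson spray on $T^*M$, with flow $\varphi^{\overline V}_s$, and let $\phi_\epsilon(x,p)=\frac1\epsilon\int_0^\epsilon x\big(\varphi^{\overline V}_s(x,p)\big)\,ds$ (with $\phi_0(x,p)=x$), wherever the flow is defined. There is a smooth map $(\epsilon,x,p)\mapsto\alpha_\epsilon(x,p)\in M$, defined on an open neighbourhood $U$ of $\{\epsilon=0\}\cup\{p=0\}$ in $\mathbb{R}\times T^*M$, with $\phi_\epsilon(\alpha_\epsilon(x,p),p)=x$ on $U$. Fix any such map, and put $\beta_\epsilon(x,p)=\alpha_\epsilon(x,-p)$. For $n\ge 0$ let $\hat\alpha_\epsilon=\sum_{k\le n}\frac{\epsilon^k}{k!}\partial_\epsilon^k\alpha|_{\epsilon=0}$ and $\hat\beta_\epsilon=\sum_{k\le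 n}\frac{\epsilon^k}{k!}\partial_\epsilon^k\beta|_{\epsilon=0}$ be the Taylor truncations of order $n$ in $\epsilon$. **Generating function.** For each $\epsilon$ let $h\mapsto c_\epsilon(h)$ be an arbitrary smooth function, and for $m\ge 0$ let $\hat S_{\epsilon,h}=\sum_{l=0}^m S_{\epsilon,(l)}h^l$, where $S_{\epsilon,(0)}=0$ and the other coefficients $S_{\epsilon,(l)}\in C^\infty(M)$ are given by the recursion that results from expanding at $h=0$ both sides of the Hamilton–Jacobi equation $$\partial_hS_{\epsilon,h}(x)=H\big(\alpha_\epsilon(x,dS_{\epsilon,h}(x))\big)+c_\epsilon(h),\qquad S_{\epsilon,0}=0.$$ Whenever $S_{\epsilon,h}$ is a smooth solution of this problem on a neighbourhood of $\{h=0\}$, $\hat S_{\epsilon,h}$ is its Taylor truncation of order $m$ in $h$. **The integrator.** For an open set $W\subseteq M$ let $L_{\epsilon,h}=\{(x,d\hat S_{\epsilon,h}(x)):x\in W\}$ be the part of $graph(d\hat S_{\epsilon,h})$ over $W$. It is a *local bisection* if $\hat\alpha_\epsilon|_{L_{\epsilon,h}}$ and $\hat\beta_\epsilon|_{L_{\epsilon,h}}$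 are diffeomorphisms onto open subsets of $M$, and a *bisection* if these subsets are both $M$. The K-HJ Poisson integrator is the map $$M^{KHJ}_{\epsilon,h}=\hat\alpha_\epsilon\circ\big(\hat\beta_\epsilon|_{L_{\epsilon,h}}\big)^{-1}:\ \hat\beta_\epsilon(L_{\epsilon,h})\to M .$$ Then, for all $n,m\ge 0$: 1. For every compact $K\subset M$ there are an open $W\supseteq K$ and $\delta>0$ such that, for all $|\epsilon|,|h|<\delta$, $L_{\epsilon,h}$ is a local bisection and $K\subseteq\hat\beta_\epsilon(L_{\epsilon,h})$, so that $M^{KHJ}_{\epsilon,h}$ is defined on $K$. 2. (Self-adjointness.) For all real $\epsilon,h$ and every open $W$ such that $L_{\epsilon,h}$ is a local bisection, $L_{\epsilon,-h}$ is a local bisection too, $M^{KHJ}_{\epsilon,-h}$ is a bijection from $\hat\beta_\epsilon(L_{\epsilon,-h})$ onto $\hat\beta_\epsilon(L_{\epsilon,h})$, and $$\big(M^{KHJ}_{\epsilon,h}\big)^*:=\big(M^{KHJ}_{\epsilon,-h}\big)^{-1}=M^{KHJ}_{\epsilon,h}\quad\text{on }\hat\beta_\epsilon(L_{\epsilon,h}).$$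 In particular, if $W=M$ and $L_{\epsilon,h}$ is a bisection, then so is $L_{\epsilon,-h}$, and $M^{KHJ}_{\epsilon,\pm h}$ are mutually inverse bijections $M\to M$. -/

import Mathlib

open scoped ContDiff

namespace KHJ

/-- The manifold `M = ℝ^d` with its linear coordinates `x^i`. The same type is used for the
components `p_i` of a covector, so that `T*M` is `Coord d × Coord d` with coordinates `(x, p)`. -/
abbrev Coord (d : ℕ) := Fin d → ℝ

/-- The differential of `f` at `x`, as the covector with components `∂f/∂x^i`. -/
noncomputable def differential {d : ℕ} (f : Coord d → ℝ) (x : Coord d) : Coord d :=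
  fun i => fderiv ℝ f x (Pi.single i 1)

/-- A Poisson tensor on `ℝ^d`, given by its components `π^{ij} = {x^i, x^j}`. -/
structure IsPoissonTensor {d : ℕ} (π : Coord d → Matrix (Fin d) (Fin d) ℝ) : Prop where
  smooth : ∀ i j, ContDiff ℝ ∞ (fun x => π x i j)
  skew : ∀ x i j, π x j i = -π x i j
  jacobi : ∀ x i j k,
    ∑ l, (π x i l * differential (fun y => π y j k) x l
        + π x j l * differential (fun y => π y k i) x l
        + π x k l * differential (fun y => π y i j) x l) = 0

/-- The flat Poisson spray `V(x,p) = -π^{ij}(x) p_i ∂/∂x^j` on `T*M`. -/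
def spray {d : ℕ} (π : Coord d → Matrix (Fin d) (Fin d) ℝ) (z : Coord d × Coord d) :
    Coord d × Coord d :=
  (fun j => -∑ i, π z.1 i j * z.2 i, 0)

/-- `φ_ε(y,p) = x`: the integral curve of the spray through `(y,p)` is defined on the whole time
interval between `0` and `ε`, and the average `ε⁻¹ ∫_0^ε x(s) ds` of its `x`-component is `x`
(for `ε = 0` the average is its limiting value `y`). -/
def IsXAverage {d : ℕ} (π : Coord d → Matrix (Fin d) (Fin d) ℝ) (ε : ℝ) (y p x : Coord d) : Prop :=
  ∃ γ : ℝ → Coord d × Coord d, γ 0 = (y, p) ∧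
    IsIntegralCurveOn γ (fun _ => spray π) (Set.uIcc 0 ε) ∧
    x = if ε = 0 then y else ε⁻¹ • ∫ s in (0 : ℝ)..ε, (γ s).1

/-- `α` is the Karasev map `(ε, x, p) ↦ α_ε(x, p)`: a smooth map on a neighbourhood `U` of
`{ε = 0} ∪ {p = 0}` (so that `U_ε = {(x,p) | (ε,x,p) ∈ U}` is a neighbourhood of the zero section)
which solves the implicit relation `φ_ε(α_ε(x,p), p) = x`. -/
structure IsKarasevMap {d : ℕ} (π : Coord d → Matrix (Fin d) (Fin d) ℝ)
    (U : Set (ℝ × Coord d × Coord d)) (α : ℝ → Coord d → Coord d → Coord d) : Prop where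
  isOpen : IsOpen U
  zero_mem : ∀ x p, ((0 : ℝ), x, p) ∈ U
  section_mem : ∀ ε x, (ε, x, (0 : Coord d)) ∈ U
  smooth : ContDiffOn ℝ ∞ (fun w : ℝ × Coord d × Coord d => α w.1 w.2.1 w.2.2) U
  relation : ∀ ε x p, (ε, x, p) ∈ U → IsXAverage π ε (α ε x p) p x

/-- The truncation `τ^n[f_ε](z) = ∑_{k ≤ n} ε^k/k! ∂_ε^k f|_{(z,0)}` of a family `f_ε(z)`. -/
noncomputable def truncation {X : Type*} {d : ℕ} (n : ℕ) (f : ℝ → X → Coord d) (ε : ℝ) (z : X) :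
    Coord d :=
  ∑ k ∈ Finset.range (n + 1), (ε ^ k / (k.factorial : ℝ)) • iteratedDeriv k (fun e => f e z) 0

/-- The approximate source map: the order `n` truncation of `α_ε`. -/
noncomputable def alphaHat {d : ℕ} (α : ℝ → Coord d → Coord d → Coord d) (n : ℕ) (ε : ℝ) :
    Coord d × Coord d → Coord d :=
  truncation n (fun e z => α e z.1 z.2) ε

/-- The approximate target map: the order `n` truncation of `β_ε(x,p) = α_ε(x,-p)`. -/
noncomputable def betaHat {d : ℕ} (α : ℝ → Coord d → Coord d → Coord d) (n : ℕ) (ε : ℝ) :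
    Coord d × Coord d → Coord d :=
  truncation n (fun e z => α e z.1 (-z.2)) ε

/-- `S = (S_h)` is an exact solution, near `h = 0`, of the Hamilton-Jacobi equation
`∂_h S_h(x) = H(α_ε(x, dS_h(x))) + c(h)` with `S_0 = 0`. -/
structure IsHJSolution {d : ℕ} (U : Set (ℝ × Coord d × Coord d))
    (α : ℝ → Coord d → Coord d → Coord d) (H : Coord d → ℝ) (ε : ℝ) (c : ℝ → ℝ)
    (N : Set (ℝ × Coord d)) (S : ℝ → Coord d → ℝ) : Prop where
  isOpen : IsOpen N
  zero_mem : ∀ x, ((0 : ℝ), x) ∈ N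
  smooth : ContDiffOn ℝ ∞ (fun w : ℝ × Coord d => S w.1 w.2) N
  initial : ∀ x, S 0 x = 0
  domain : ∀ h x, (h, x) ∈ N → (ε, x, differential (S h) x) ∈ U
  equation : ∀ h x, (h, x) ∈ N →
    HasDerivAt (fun t => S t x) (H (α ε x (differential (S h) x)) + c h) h

/-- The generating function `Ŝ_{ε,h} = ∑_{l ≤ m} S_{ε,(l)} h^l` of order `m`, with the
coefficients obtained recursively by expanding both sides of the Hamilton-Jacobi equation at
`h = 0`: `S_{ε,(0)} = 0`, and `(m+1) S_{ε,(m+1)}(x)` is the coefficient of `h^m` in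
`H(α_ε(x, dŜ(x))) + c(h)`, where `Ŝ` is the generating function of order `m`. -/
noncomputable def hjTrunc {d : ℕ} (α : ℝ → Coord d → Coord d → Coord d) (H : Coord d → ℝ)
    (ε : ℝ) (c : ℝ → ℝ) : ℕ → ℝ → Coord d → ℝ
  | 0 => fun _ _ => 0
  | m + 1 => fun h x => hjTrunc α H ε c m h x +
      h ^ (m + 1) / ((m + 1).factorial : ℝ) *
        iteratedDeriv m
          (fun t => H (α ε x (differential (hjTrunc α H ε c m t) x)) + c t) 0

/-- The part of `graph(dS) ⊆ T*M` which lies over `W`. -/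
def graphD {d : ℕ} (S : Coord d → ℝ) (W : Set (Coord d)) : Set (Coord d × Coord d) :=
  (fun x => (x, differential S x)) '' W

/-- For a smooth map `f : T*M → M`: the set `L` is an embedded submanifold and the restriction
`f|_L : L → f(L)` is a diffeomorphism onto an open subset of `M`, that is, it has a smooth
inverse on `f(L)`. -/
def IsDiffeoOnto {d : ℕ} (f : Coord d × Coord d → Coord d) (L : Set (Coord d × Coord d)) : Prop :=
  ContDiff ℝ ∞ f ∧ IsOpen (f '' L) ∧
    ∃ s : Coord d → Coord d × Coord d, ContDiffOn ℝ ∞ s (f '' L) ∧ ∀ z ∈ L, s (f z) = z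

/-- `L` is a local bisection for the maps `a, b : T*M → M`. -/
def IsLocalBisection {d : ℕ} (a b : Coord d × Coord d → Coord d) (L : Set (Coord d × Coord d)) :
    Prop :=
  IsDiffeoOnto a L ∧ IsDiffeoOnto b L

/-- `L` is a (global) bisection for the maps `a, b : T*M → M`. -/
def IsBisection {d : ℕ} (a b : Coord d × Coord d → Coord d) (L : Set (Coord d × Coord d)) : Prop :=
  IsLocalBisection a b L ∧ a '' L = Set.univ ∧ b '' L = Set.univ

/-- The induced map `a ∘ (b|_L)⁻¹`, with domain `b(L)`. -/
noncomputable def inducedMap {d : ℕ} (a b : Coord d × Coord d → Coord d)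
    (L : Set (Coord d × Coord d)) (x : Coord d) : Coord d :=
  a (Function.invFunOn b L x)

/-- The Lagrangian `graph(dŜ_{ε,h})` over `W`. -/
noncomputable def lagr {d : ℕ} (α : ℝ → Coord d → Coord d → Coord d) (H : Coord d → ℝ)
    (c : ℝ → ℝ → ℝ) (m : ℕ) (W : Set (Coord d)) (ε h : ℝ) : Set (Coord d × Coord d) :=
  graphD (hjTrunc α H ε (c ε) m h) W

/-- The K-HJ Poisson integrator `α̂_ε ∘ (β̂_ε|_L)⁻¹`, where `L` is the part of
`graph(dŜ_{ε,h})` over `W`. -/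
noncomputable def khjMap {d : ℕ} (α : ℝ → Coord d → Coord d → Coord d) (H : Coord d → ℝ)
    (c : ℝ → ℝ → ℝ) (n m : ℕ) (W : Set (Coord d)) (ε h : ℝ) : Coord d → Coord d :=
  inducedMap (alphaHat α n ε) (betaHat α n ε) (lagr α H c m W ε h)

/-- The domain `β̂_ε(L)` of the K-HJ Poisson integrator. -/
noncomputable def khjDomain {d : ℕ} (α : ℝ → Coord d → Coord d → Coord d) (H : Coord d → ℝ)
    (c : ℝ → ℝ → ℝ) (n m : ℕ) (W : Set (Coord d)) (ε h : ℝ) : Set (Coord d) :=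
  betaHat α n ε '' lagr α H c m W ε h

/-- The adjoint method `(M_{-h})⁻¹` of a method `M_h : D_h → M`. -/
noncomputable def adjointMethod {d : ℕ} (M : ℝ → Coord d → Coord d) (D : ℝ → Set (Coord d))
    (h : ℝ) : Coord d → Coord d :=
  Function.invFunOn (M (-h)) (D (-h))

end KHJ

/-! Self-adjointness comes from the reflection (x, p) ↦ (x, -p). It exchanges `alphaHat` and
`betaHat` for every truncation order n, and it carries L_{ε,h} onto L_{ε,-h}. So the map induced by
L_{ε,-h} is β̂ ∘ (α̂|_L)⁻¹ with L = L_{ε,h}, the inverse of the map induced by L (`lagr_neg`,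
`reflect_selfAdjoint`).

All rests on dŜ_{ε,-h} = -dŜ_{ε,h}. Since c adds only a function of h, one may take c = 0 and show
that the even coefficients of Ŝ vanish (`hjCoef_even_eq_zero`). Put a = H ∘ α_ε and b = H ∘ β_ε, so
that b(x, p) = a(x, -p). If {a, b} = 0 near the zero section, the difference D of a and b along
graph(dS) satisfies a linear transport equation whose source is the residual of the Hamilton-Jacobi
equation, and D = 0 at h = 0. Hence D vanishes to the order to which S is a solution
(`jet_sub_comp_graph_eq_zero`). For m odd and Ŝ odd up to order m, the m-th coefficients of a and b
along the graph are both opposite and equal, hence zero, and so is the coefficient m + 1 of Ŝ.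

The identity {a, b} = 0 says that source and target of the local symplectic groupoid commute. Near
the zero section, α_ε(x, p) and β_ε(x, p) are the endpoints y(0), y(1) of the path on [0, 1] of mean
x that follows the spray with momentum q = εp: time reversal keeps the mean and changes the sign of
q. These paths come from the implicit function theorem in C([0, 1], ℝ^d) (`exists_local_path`),
which also yields the Karasev map itself. Their derivatives in x and q solve linear matrix
equations, along which π(y(t)) is transported by the Jacobi identity; the commutation is then linear
algebra (`endpoint_identity`).

For definedness on compact sets, α̂_0(x, p) = β̂_0(x, p) = x, so for small ε and h both maps,
restricted to the graph, are C¹-close to the identity on a ball. -/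

namespace KHJ

open Filter Topology

set_option linter.unusedSectionVars false

/-! ### Taylor coefficients in one real variable, with parameters -/

section Jets

variable {X F G : Type*} [NormedAddCommGroup X] [NormedSpace ℝ X]
  [NormedAddCommGroup F] [NormedSpace ℝ F] [NormedAddCommGroup G] [NormedSpace ℝ G]

/-- Smoothness of `f(t, x)` at all points of `{t = 0}`. -/
def SmoothAtZero (f : ℝ × X → F) : Prop := ∀ x, ContDiffAt ℝ ∞ f (0, x)

/-- The `j`-th derivative of `f(t, x)` in `t` at `t = 0`. -/
noncomputable def jet (j : ℕ) (f : ℝ × X → F) (x : X) : F :=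
  iteratedDeriv j (fun t => f (t, x)) 0

/-- The directional derivative of `f` along a constant vector. -/
noncomputable def dirDeriv (v : X) (f : X → F) (z : X) : F := fderiv ℝ f z v

theorem eventually_slice {P : ℝ × X → Prop} {t : ℝ} {x : X} (h : ∀ᶠ z in 𝓝 (t, x), P z) :
    ∀ᶠ s in 𝓝 t, P (s, x) :=
  (Continuous.prodMk_left x).continuousAt.eventually h

theorem jet_congr {f g : ℝ × X → F} {x : X} (h : f =ᶠ[𝓝 (0, x)] g) (j : ℕ) :
    jet j f x = jet j g x :=
  Filter.EventuallyEq.iteratedDeriv_eq j (eventually_slice h)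

theorem contDiffAt_slice {f : ℝ × X → F} {n : ℕ∞ω} {t : ℝ} {x : X} (h : ContDiffAt ℝ n f (t, x)) :
    ContDiffAt ℝ n (fun t => f (t, x)) t :=
  ContDiffAt.comp t (f := fun t : ℝ => (t, x)) h (by fun_prop)

theorem SmoothAtZero.eventually_differentiableAt {f : ℝ × X → F} (h : SmoothAtZero f) (x : X) :
    ∀ᶠ z in 𝓝 ((0 : ℝ), x), DifferentiableAt ℝ f z := by
  have h1 : ContDiffAt ℝ 1 f (0, x) := (h x).of_le (by norm_cast)
  filter_upwards [h1.eventually (by simp)] with z hz using hz.differentiableAt (by simp)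

theorem SmoothAtZero.dirDeriv {f : ℝ × X → F} (h : SmoothAtZero f) (v : ℝ × X) :
    SmoothAtZero (dirDeriv v f) := fun x =>
  ((h x).fderiv_right (m := ∞) (by simp)).clm_apply contDiffAt_const

/-- Smoothness of order 2 at (0, x) spreads to a neighbourhood, so the mixed derivatives agree near
the point and not only at it, as the comparison of jets requires. -/
theorem dirDeriv_comm {f : ℝ × X → F} (h : SmoothAtZero f) (v w : ℝ × X) (x : X) :
    dirDeriv v (dirDeriv w f) =ᶠ[𝓝 (0, x)] dirDeriv w (dirDeriv v f) := by
  have h2 : ContDiffAt ℝ 2 f (0, x) := (h x).of_le (by norm_cast)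
  filter_upwards [h2.eventually (by simp)] with z hz
  have hs := hz.isSymmSndFDerivAt (by simp)
  have hd : DifferentiableAt ℝ (fderiv ℝ f) z :=
    (hz.fderiv_right (m := 1) (by norm_num)).differentiableAt (by simp)
  have e : ∀ a b : ℝ × X, fderiv ℝ (fun z => fderiv ℝ f z a) z b = fderiv ℝ (fderiv ℝ f) z b a := by
    intro a b
    rw [fderiv_clm_apply hd (differentiableAt_const a)]
    simp
  change fderiv ℝ (fun z => fderiv ℝ f z w) z v = fderiv ℝ (fun z => fderiv ℝ f z v) z w
  rw [e, e]
  exact hs v w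

theorem deriv_slice {f : ℝ × X → F} {t : ℝ} {x : X} (h : DifferentiableAt ℝ f (t, x)) :
    deriv (fun s => f (s, x)) t = dirDeriv (1, 0) f (t, x) := by
  have h1 : HasDerivAt (fun s : ℝ => (s, x)) ((1 : ℝ), (0 : X)) t :=
    (hasDerivAt_id t).prodMk (hasDerivAt_const t x)
  exact (h.hasFDerivAt.comp_hasDerivAt t h1).deriv

theorem fderiv_slice {f : ℝ × X → F} {t : ℝ} {x : X} (h : DifferentiableAt ℝ f (t, x)) (v : X) :
    fderiv ℝ (fun y => f (t, y)) x v = dirDeriv (0, v) f (t, x) := by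
  have h1 : HasFDerivAt (fun y : X => (t, y)) (ContinuousLinearMap.inr ℝ ℝ X) x :=
    hasFDerivAt_prodMk_right t x
  have h2 := (h.hasFDerivAt.comp x h1).fderiv
  exact congrArg (fun L : X →L[ℝ] F => L v) h2

theorem jet_zero (f : ℝ × X → F) (x : X) : jet 0 f x = f (0, x) := by
  simp [jet]

/-- Trades a derivative of the slice for a directional derivative of f itself, which is again in the
class `SmoothAtZero`; inductions on j then run over all f at once. -/
theorem jet_succ {f : ℝ × X → F} (h : SmoothAtZero f) (j : ℕ) (x : X) :
    jet (j + 1) f x = jet j (dirDeriv (1, 0) f) x := by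
  unfold jet
  rw [iteratedDeriv_succ']
  apply Filter.EventuallyEq.iteratedDeriv_eq
  filter_upwards [eventually_slice (h.eventually_differentiableAt x)] with t ht
  exact deriv_slice ht

theorem contDiff_jet {f : ℝ × X → F} (h : SmoothAtZero f) (j : ℕ) : ContDiff ℝ ∞ (jet j f) := by
  induction j generalizing f with
  | zero =>
    rw [show jet 0 f = fun x => f (0, x) from funext (jet_zero f), contDiff_iff_contDiffAt]
    intro x
    exact ContDiffAt.comp x (f := fun y : X => ((0 : ℝ), y)) (h x) (by fun_prop)
  | succ j ih =>
    rw [show jet (j + 1) f = jet j (dirDeriv (1, 0) f) from funext (jet_succ h j)]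
    exact ih (h.dirDeriv _)

/-- Differentiation in `x` commutes with the Taylor coefficients in `t`. -/
theorem fderiv_jet {f : ℝ × X → F} (h : SmoothAtZero f) (j : ℕ) (x v : X) :
    fderiv ℝ (jet j f) x v = jet j (dirDeriv (0, v) f) x := by
  induction j generalizing f with
  | zero =>
    rw [jet_zero, show jet 0 f = fun x => f (0, x) from funext (jet_zero f)]
    exact fderiv_slice ((h x).differentiableAt (by simp)) v
  | succ j ih =>
    rw [show jet (j + 1) f = jet j (dirDeriv (1, 0) f) from funext (jet_succ h j),
      ih (h.dirDeriv _), jet_succ (h.dirDeriv _)]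
    exact jet_congr (dirDeriv_comm h _ _ x) j

/-- The Taylor coefficients of `g ∘ u` depend only on those of `u`. -/
theorem iteratedDeriv_comp_congr {u v : ℝ → F} {g : F → G} {m : ℕ}
    (hu : ContDiffAt ℝ ∞ u 0) (hv : ContDiffAt ℝ ∞ v 0) (hg : ContDiffAt ℝ ∞ g (u 0))
    (h : ∀ j ≤ m, iteratedDeriv j u 0 = iteratedDeriv j v 0) :
    iteratedDeriv m (fun t => g (u t)) 0 = iteratedDeriv m (fun t => g (v t)) 0 := by
  have h0 : u 0 = v 0 := by simpa using h 0 (Nat.zero_le _)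
  have hm : ((m : ℕ) : ℕ∞ω) ≤ ∞ := by norm_cast; exact le_top
  -- Faà di Bruno: both sides are sums over ordered partitions, in which u and v enter only through
  -- derivatives of order a part size, at most m.
  have e1 := iteratedDeriv_vcomp_eq_sum_orderedFinpartition hg hu hm
  have e2 := iteratedDeriv_vcomp_eq_sum_orderedFinpartition (g := g) (h0 ▸ hg) hv hm
  simp only [Function.comp_def] at e1 e2
  rw [e1, e2, h0]
  refine Finset.sum_congr rfl fun c _ => ?_
  congr 1
  funext i
  exact h _ (c.partSize_le i)

theorem iteratedDeriv_mul_eq_zero {u v : ℝ → ℝ} {m : ℕ}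
    (hu : ContDiffAt ℝ ∞ u 0) (hv : ContDiffAt ℝ ∞ v 0)
    (h : ∀ j ≤ m, iteratedDeriv j v 0 = 0) : iteratedDeriv m (fun t => u t * v t) 0 = 0 := by
  have hm : ((m : ℕ) : ℕ∞ω) ≤ ∞ := by norm_cast; exact le_top
  have := iteratedDeriv_mul (hu.of_le hm) (hv.of_le hm)
  rw [show (fun t => u t * v t) = u * v from rfl, this]
  refine Finset.sum_eq_zero fun i _ => ?_
  rw [h _ (Nat.sub_le _ _), mul_zero]

/-- The Taylor coefficients of a polynomial in `t`. -/
theorem iteratedDeriv_poly (a : ℕ → ℝ) (m j : ℕ) :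
    iteratedDeriv j (fun t : ℝ => ∑ l ∈ Finset.range m, t ^ l / (l.factorial : ℝ) * a l) 0 =
      if j < m then a j else 0 := by
  rw [iteratedDeriv_fun_sum (fun i _ => by fun_prop)]
  have : ∀ l, iteratedDeriv j (fun t : ℝ => t ^ l / (l.factorial : ℝ) * a l) 0 =
      if j = l then a l else 0 := by
    intro l
    rw [show (fun t : ℝ => t ^ l / (l.factorial : ℝ) * a l) =
      fun t => t ^ l * (a l / (l.factorial : ℝ)) by funext t; ring]
    rw [iteratedDeriv_mul_const_field, iteratedDeriv_fun_pow_zero]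
    split_ifs
    · have : (l.factorial : ℝ) ≠ 0 := by positivity
      field_simp
    · simp
  simp [this]

end Jets

/-! ### The Hamilton-Jacobi recursion -/

section HamiltonJacobi

theorem differential_apply {d : ℕ} (f : Coord d → ℝ) (x : Coord d) (i : Fin d) :
    differential f x i = fderiv ℝ f x (Pi.single i 1) := rfl

theorem differential_zero {d : ℕ} (x : Coord d) : differential (fun _ => (0 : ℝ)) x = 0 := by
  funext i
  simp [differential]

theorem differential_add_const {d : ℕ} (f : Coord d → ℝ) (k : ℝ) (x : Coord d) :
    differential (fun y => f y + k) x = differential f x := by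
  funext i
  simp [differential]

theorem contDiffAt_differential {Y : Type*} [NormedAddCommGroup Y] [NormedSpace ℝ Y] {d : ℕ}
    {g : Y × Coord d → ℝ} {z : Y × Coord d} (h : ContDiffAt ℝ ∞ g z) :
    ContDiffAt ℝ ∞ (fun z : Y × Coord d => differential (fun y => g (z.1, y)) z.2) z := by
  rw [contDiffAt_pi]
  intro i
  have h1 : ContDiffAt ℝ 1 g z := h.of_le (by norm_cast)
  have h2 : ContDiffAt ℝ ∞ (fun z => fderiv ℝ g z ((0 : Y), (Pi.single i 1 : Coord d))) z :=
    (h.fderiv_right (m := ∞) (by simp)).clm_apply contDiffAt_const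
  refine h2.congr_of_eventuallyEq ?_
  filter_upwards [h1.eventually (by simp)] with w hw
  have hd : HasFDerivAt g (fderiv ℝ g w) (w.1, w.2) :=
    (hw.differentiableAt (by simp)).hasFDerivAt
  have h3 := (hd.comp w.2 (hasFDerivAt_prodMk_right (𝕜 := ℝ) w.1 w.2)).fderiv
  exact congrArg (fun L : Coord d →L[ℝ] ℝ => L (Pi.single i 1)) h3

theorem iteratedDeriv_apply {d : ℕ} {u : ℝ → Coord d} (hu : ContDiffAt ℝ ∞ u 0) (j : ℕ)
    (i : Fin d) : iteratedDeriv j u 0 i = iteratedDeriv j (fun t => u t i) 0 := by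
  have h := (ContinuousLinearMap.proj (R := ℝ) (φ := fun _ : Fin d => ℝ) i).iteratedFDeriv_comp_left
    (i := j) hu (by norm_cast; exact le_top)
  have h2 := congrArg (fun L => L (fun _ => (1 : ℝ))) h
  exact h2.symm

/-- Taylor coefficients in `t` commute with the differential in `x`. -/
theorem iteratedDeriv_differential {d : ℕ} {f : ℝ × Coord d → ℝ} (h : SmoothAtZero f) (j : ℕ)
    (x : Coord d) :
    iteratedDeriv j (fun t => differential (fun y => f (t, y)) x) 0 = differential (jet j f) x := by
  funext i
  rw [iteratedDeriv_apply (contDiffAt_slice (contDiffAt_differential (h x))), differential_apply,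
    fderiv_jet h]
  apply Filter.EventuallyEq.iteratedDeriv_eq
  filter_upwards [eventually_slice (h.eventually_differentiableAt x)] with t ht
  exact fderiv_slice ht _

/-- The coefficients `l! S_(l)` of the generating function. -/
noncomputable def hjCoef {d : ℕ} (α : ℝ → Coord d → Coord d → Coord d) (H : Coord d → ℝ)
    (ε : ℝ) (c : ℝ → ℝ) : ℕ → Coord d → ℝ
  | 0 => fun _ => 0
  | l + 1 => fun x => iteratedDeriv l
      (fun t => H (α ε x (differential (hjTrunc α H ε c l t) x)) + c t) 0

variable {d : ℕ} {α : ℝ → Coord d → Coord d → Coord d} {H : Coord d → ℝ}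

theorem hjTrunc_eq_sum (ε : ℝ) (c : ℝ → ℝ) (m : ℕ) (h : ℝ) (x : Coord d) :
    hjTrunc α H ε c m h x =
      ∑ l ∈ Finset.range (m + 1), h ^ l / (l.factorial : ℝ) * hjCoef α H ε c l x := by
  induction m with
  | zero => simp [hjTrunc, hjCoef]
  | succ m ih => rw [Finset.sum_range_succ, ← ih]; rfl

theorem hjTrunc_zero_right (ε : ℝ) (c : ℝ → ℝ) (m : ℕ) (x : Coord d) :
    hjTrunc α H ε c m 0 x = 0 := by
  rw [hjTrunc_eq_sum, Finset.sum_range_succ']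
  simp [hjCoef]

theorem differential_hjTrunc_zero_right (ε : ℝ) (c : ℝ → ℝ) (m : ℕ) (x : Coord d) :
    differential (hjTrunc α H ε c m 0) x = 0 := by
  rw [show hjTrunc α H ε c m 0 = fun _ => (0 : ℝ) from funext (hjTrunc_zero_right ε c m)]
  exact differential_zero x

/-- Joint smoothness of `H(α_ε(x, p))` at the zero section. -/
def SmoothAtSection (α : ℝ → Coord d → Coord d → Coord d) (H : Coord d → ℝ) : Prop :=
  ∀ ε x, ContDiffAt ℝ ∞ (fun w : ℝ × Coord d × Coord d => H (α w.1 w.2.1 w.2.2)) (ε, x, 0)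

theorem contDiff_hjTrunc_of_coef {m : ℕ}
    (h : ∀ l ≤ m, ContDiff ℝ ∞ (fun z : ℝ × Coord d => hjCoef α H z.1 0 l z.2)) :
    ContDiff ℝ ∞ (fun z : (ℝ × ℝ) × Coord d => hjTrunc α H z.1.2 0 m z.1.1 z.2) := by
  simp_rw [hjTrunc_eq_sum]
  refine ContDiff.sum fun l hl => ?_
  refine ContDiff.mul (by fun_prop) ?_
  exact (h l (by simpa [Nat.lt_succ_iff] using hl)).comp
    (f := fun z : (ℝ × ℝ) × Coord d => (z.1.2, z.2)) (by fun_prop)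

/-- At h = 0 the differential of each truncation is zero, so the recursion only sees the germ of H ∘
α at the zero section. Joint smoothness in (ε, x) is needed for the estimates at small ε. -/
theorem contDiff_hjCoef (hs : SmoothAtSection α H) (l : ℕ) :
    ContDiff ℝ ∞ (fun z : ℝ × Coord d => hjCoef α H z.1 0 l z.2) := by
  induction l using Nat.strong_induction_on with
  | _ l ih =>
    cases l with
    | zero => simpa [hjCoef] using contDiff_const
    | succ l =>
      have h1 := contDiff_hjTrunc_of_coef (m := l) (fun k hk => ih k (by omega))
      let f : ℝ × (ℝ × Coord d) → ℝ := fun w =>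
        H (α w.2.1 w.2.2 (differential (hjTrunc α H w.2.1 0 l w.1) w.2.2)) + 0
      have hf : SmoothAtZero f := by
        rintro ⟨ε, x⟩
        refine ContDiffAt.add ?_ contDiffAt_const
        have h2 : ContDiffAt ℝ ∞ (fun w : ℝ × (ℝ × Coord d) =>
            differential (hjTrunc α H w.2.1 0 l w.1) w.2.2) (0, ε, x) :=
          ContDiffAt.comp (0, ε, x)
            (f := fun w : ℝ × (ℝ × Coord d) => (((w.1, w.2.1) : ℝ × ℝ), w.2.2))
            (contDiffAt_differential (h1.contDiffAt (x := ((0, ε), x)))) (by fun_prop)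
        have h3 : ContDiffAt ℝ ∞ (fun w : ℝ × (ℝ × Coord d) =>
            (w.2.1, w.2.2, differential (hjTrunc α H w.2.1 0 l w.1) w.2.2)) (0, ε, x) :=
          ContDiffAt.prodMk (by fun_prop) (ContDiffAt.prodMk (by fun_prop) h2)
        refine ContDiffAt.comp (0, ε, x) (f := fun w : ℝ × (ℝ × Coord d) =>
            (w.2.1, w.2.2, differential (hjTrunc α H w.2.1 0 l w.1) w.2.2))
            (g := fun w : ℝ × Coord d × Coord d => H (α w.1 w.2.1 w.2.2)) ?_ h3
        simp only [differential_hjTrunc_zero_right]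
        exact hs ε x
      exact contDiff_jet hf l

theorem contDiff_hjTrunc (hs : SmoothAtSection α H) (m : ℕ) :
    ContDiff ℝ ∞ (fun z : (ℝ × ℝ) × Coord d => hjTrunc α H z.1.2 0 m z.1.1 z.2) :=
  contDiff_hjTrunc_of_coef fun l _ => contDiff_hjCoef hs l

theorem contDiff_hjTrunc_fixed (hs : SmoothAtSection α H) (ε : ℝ) (m : ℕ) :
    ContDiff ℝ ∞ (fun z : ℝ × Coord d => hjTrunc α H ε 0 m z.1 z.2) :=
  (contDiff_hjTrunc hs m).comp (f := fun z : ℝ × Coord d => ((z.1, ε), z.2)) (by fun_prop)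

theorem contDiffAt_hamiltonian_differential (hs : SmoothAtSection α H) (ε : ℝ)
    {S : ℝ × Coord d → ℝ} (x : Coord d) (hS : ContDiffAt ℝ ∞ S (0, x))
    (h0 : differential (fun y => S (0, y)) x = 0) :
    ContDiffAt ℝ ∞ (fun t => H (α ε x (differential (fun y => S (t, y)) x))) 0 := by
  have h2 := contDiffAt_slice (contDiffAt_differential hS)
  refine ContDiffAt.comp 0 (f := fun t : ℝ => (ε, x, differential (fun y => S (t, y)) x))
    (g := fun w : ℝ × Coord d × Coord d => H (α w.1 w.2.1 w.2.2)) ?_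
    (contDiffAt_const.prodMk (contDiffAt_const.prodMk h2))
  rw [h0]
  exact hs ε x

/-- The function `c` only adds a function of `h`, so that it does not affect the differential. -/
theorem exists_hjTrunc_eq_add (hs : SmoothAtSection α H) (ε : ℝ) {c : ℝ → ℝ}
    (hc : ContDiff ℝ ∞ c) (m : ℕ) :
    ∃ κ : ℝ → ℝ, ContDiff ℝ ∞ κ ∧ ∀ h x, hjTrunc α H ε c m h x = hjTrunc α H ε 0 m h x + κ h := by
  induction m with
  | zero => exact ⟨fun _ => 0, contDiff_const, fun h x => by simp [hjTrunc]⟩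
  | succ m ih =>
    obtain ⟨κ, hκ, e⟩ := ih
    refine ⟨fun h => κ h + h ^ (m + 1) / ((m + 1).factorial : ℝ) * iteratedDeriv m c 0,
      hκ.add (by fun_prop), fun h x => ?_⟩
    have hd : ∀ t, differential (hjTrunc α H ε c m t) x = differential (hjTrunc α H ε 0 m t) x := by
      intro t
      rw [show hjTrunc α H ε c m t = fun y => hjTrunc α H ε 0 m t y + κ t from funext (e t)]
      exact differential_add_const _ _ _
    have hm : ((m : ℕ) : ℕ∞ω) ≤ ∞ := by norm_cast; exact le_top
    have hA := contDiffAt_hamiltonian_differential hs ε x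
      (contDiff_hjTrunc_fixed hs ε m).contDiffAt (differential_hjTrunc_zero_right ε 0 m x)
    have h3 := iteratedDeriv_add (hA.of_le hm) (hc.contDiffAt.of_le hm)
    simp only [hjTrunc, hd, e, Pi.zero_apply, add_zero]
    change _ + _ * iteratedDeriv m (_ + c) 0 = _
    rw [h3]
    ring

theorem differential_hjTrunc (hs : SmoothAtSection α H) (ε : ℝ) {c : ℝ → ℝ}
    (hc : ContDiff ℝ ∞ c) (m : ℕ) (h : ℝ) (x : Coord d) :
    differential (hjTrunc α H ε c m h) x = differential (hjTrunc α H ε 0 m h) x := by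
  obtain ⟨κ, -, e⟩ := exists_hjTrunc_eq_add hs ε hc m
  rw [show hjTrunc α H ε c m h = fun y => hjTrunc α H ε 0 m h y + κ h from funext (e h)]
  exact differential_add_const _ _ _

theorem contDiff_hjTrunc_right (hs : SmoothAtSection α H) (ε : ℝ) {c : ℝ → ℝ}
    (hc : ContDiff ℝ ∞ c) (m : ℕ) :
    ContDiff ℝ ∞ (fun z : ℝ × Coord d => hjTrunc α H ε c m z.1 z.2) := by
  obtain ⟨κ, hκ, e⟩ := exists_hjTrunc_eq_add hs ε hc m
  simp_rw [e]
  exact (contDiff_hjTrunc_fixed hs ε m).add (hκ.comp contDiff_fst)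

theorem jet_hjTrunc (ε : ℝ) (c : ℝ → ℝ) (m j : ℕ) (x : Coord d) :
    jet j (fun z : ℝ × Coord d => hjTrunc α H ε c m z.1 z.2) x =
      if j < m + 1 then hjCoef α H ε c j x else 0 := by
  simp only [jet, hjTrunc_eq_sum]
  exact iteratedDeriv_poly (fun l => hjCoef α H ε c l x) (m + 1) j

/-- Truncations which agree to order `m` give the same `m`-th Taylor coefficient of the right hand
side of the Hamilton-Jacobi equation. -/
theorem iteratedDeriv_rhs_congr (hs : SmoothAtSection α H) (ε : ℝ) {S R : ℝ × Coord d → ℝ}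
    (hS : SmoothAtZero S) (hR : SmoothAtZero R) (m : ℕ) (x : Coord d)
    (h0 : ∀ y, S (0, y) = 0) (h : ∀ j ≤ m, jet j S = jet j R) :
    iteratedDeriv m (fun t => H (α ε x (differential (fun y => S (t, y)) x))) 0 =
      iteratedDeriv m (fun t => H (α ε x (differential (fun y => R (t, y)) x))) 0 := by
  have hg : ContDiffAt ℝ ∞ (fun p => H (α ε x p)) 0 :=
    ContDiffAt.comp (0 : Coord d) (f := fun p : Coord d => (ε, x, p))
      (g := fun w : ℝ × Coord d × Coord d => H (α w.1 w.2.1 w.2.2)) (hs ε x) (by fun_prop)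
  refine iteratedDeriv_comp_congr (g := fun p => H (α ε x p))
    (contDiffAt_slice (contDiffAt_differential (hS x)))
    (contDiffAt_slice (contDiffAt_differential (hR x))) ?_ ?_
  · simp only [h0, differential_zero]
    exact hg
  · intro j hj
    rw [iteratedDeriv_differential hS, iteratedDeriv_differential hR, h j hj]

/-- The coefficients of the recursion are the Taylor coefficients of every exact solution. -/
theorem hjCoef_eq_jet (hs : SmoothAtSection α H) {ε : ℝ} {c : ℝ → ℝ} (hc : ContDiff ℝ ∞ c)
    {U : Set (ℝ × Coord d × Coord d)} {N : Set (ℝ × Coord d)} {S : ℝ → Coord d → ℝ}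
    (hS : IsHJSolution U α H ε c N S) (l : ℕ) :
    hjCoef α H ε c l = jet l (fun z : ℝ × Coord d => S z.1 z.2) := by
  have hsm : SmoothAtZero (fun z : ℝ × Coord d => S z.1 z.2) := fun x =>
    hS.smooth.contDiffAt (hS.isOpen.mem_nhds (hS.zero_mem x))
  have h0 : ∀ x, differential (fun y => S 0 y) x = 0 := fun x => by
    rw [show (fun y => S 0 y) = fun _ => (0 : ℝ) from funext hS.initial]
    exact differential_zero x
  induction l using Nat.strong_induction_on with
  | _ l ih =>
    funext x
    cases l with
    | zero => simp [hjCoef, jet_zero, hS.initial]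
    | succ l =>
      have hl : ((l : ℕ) : ℕ∞ω) ≤ ∞ := by norm_cast; exact le_top
      have hT : SmoothAtZero (fun z : ℝ × Coord d => hjTrunc α H ε c l z.1 z.2) := fun x =>
        (contDiff_hjTrunc_right hs ε hc l).contDiffAt
      have e1 : jet (l + 1) (fun z : ℝ × Coord d => S z.1 z.2) x =
          iteratedDeriv l ((fun t => H (α ε x (differential (S t) x))) + c) 0 := by
        unfold jet
        rw [iteratedDeriv_succ']
        apply Filter.EventuallyEq.iteratedDeriv_eq
        have := eventually_slice (hS.isOpen.eventually_mem (hS.zero_mem x))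
        filter_upwards [this] with t ht
        exact (hS.equation t x ht).deriv
      have hA := contDiffAt_hamiltonian_differential hs ε x (hsm x) (h0 x)
      have hB := contDiffAt_hamiltonian_differential hs ε x (hT x)
        (differential_hjTrunc_zero_right ε c l x)
      rw [e1, iteratedDeriv_add (hA.of_le hl) (hc.contDiffAt.of_le hl)]
      change iteratedDeriv l ((fun t => H (α ε x (differential (hjTrunc α H ε c l t) x))) + c) 0 = _
      rw [iteratedDeriv_add (hB.of_le hl) (hc.contDiffAt.of_le hl)]
      congr 1
      -- By induction the truncation of order l and S have the same jets up to order l, and these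
      -- determine the l-th coefficient of the right-hand side.
      refine iteratedDeriv_rhs_congr hs ε hT hsm l x (fun y => hjTrunc_zero_right ε c l y) ?_
      intro j hj
      rw [← ih j (by omega)]
      funext y
      rw [jet_hjTrunc, if_pos (by omega)]

theorem hjTrunc_eq_taylor (hs : SmoothAtSection α H) {ε : ℝ} {c : ℝ → ℝ} (hc : ContDiff ℝ ∞ c)
    {U : Set (ℝ × Coord d × Coord d)} {N : Set (ℝ × Coord d)} {S : ℝ → Coord d → ℝ}
    (hS : IsHJSolution U α H ε c N S) (m : ℕ) (h : ℝ) (x : Coord d) :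
    hjTrunc α H ε c m h x = ∑ l ∈ Finset.range (m + 1),
      h ^ l / (l.factorial : ℝ) * iteratedDeriv l (fun t => S t x) 0 := by
  simp_rw [hjTrunc_eq_sum, hjCoef_eq_jet hs hc hS]
  rfl

end HamiltonJacobi

/-! ### Vanishing of the even coefficients -/

section Oddness

variable {d : ℕ}

/-- The canonical Poisson bracket on `T*ℝ^d`. -/
noncomputable def canonicalBracket (a b : Coord d × Coord d → ℝ) (z : Coord d × Coord d) : ℝ :=
  ∑ k, (dirDeriv (Pi.single k 1, 0) a z * dirDeriv (0, Pi.single k 1) b z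
    - dirDeriv (0, Pi.single k 1) a z * dirDeriv (Pi.single k 1, 0) b z)

theorem coord_eq_sum_single (v : Coord d) : v = ∑ k, v k • (Pi.single k 1 : Coord d) := by
  simpa using pi_eq_sum_univ' v

/-- The chain rule along a graph `p = σ(t, x)`. -/
theorem dirDeriv_comp_graph {g : Coord d × Coord d → ℝ} {σ : ℝ × Coord d → Coord d}
    {z : ℝ × Coord d} (hg : DifferentiableAt ℝ g (z.2, σ z)) (hσ : DifferentiableAt ℝ σ z)
    (w : ℝ × Coord d) :
    dirDeriv w (fun z => g (z.2, σ z)) z =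
      dirDeriv (w.2, 0) g (z.2, σ z) +
        ∑ l, dirDeriv (0, Pi.single l 1) g (z.2, σ z) * dirDeriv w (fun z => σ z l) z := by
  have h1 : HasFDerivAt (fun z : ℝ × Coord d => (z.2, σ z))
      ((ContinuousLinearMap.snd ℝ ℝ (Coord d)).prod (fderiv ℝ σ z)) z :=
    hasFDerivAt_snd.prodMk hσ.hasFDerivAt
  have h2 := (hg.hasFDerivAt.comp z h1).fderiv
  have h3 : dirDeriv w (fun z => g (z.2, σ z)) z =
      fderiv ℝ g (z.2, σ z) (w.2, fderiv ℝ σ z w) :=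
    congrArg (fun L : ℝ × Coord d →L[ℝ] ℝ => L w) h2
  have h4 : ∀ l, dirDeriv w (fun z => σ z l) z = fderiv ℝ σ z w l := fun l =>
    congrArg (fun L : ℝ × Coord d →L[ℝ] ℝ => L w)
      ((hasFDerivAt_pi'.1 hσ.hasFDerivAt l).fderiv)
  rw [h3]
  have h5 : ((w.2, fderiv ℝ σ z w) : Coord d × Coord d) =
      (w.2, 0) + ∑ l, fderiv ℝ σ z w l • ((0 : Coord d), (Pi.single l 1 : Coord d)) := by
    refine Prod.ext ?_ ?_
    · simp [Prod.fst_sum]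
    · simp only [Prod.snd_add, Prod.snd_sum, Prod.smul_snd, zero_add]
      exact coord_eq_sum_single _
  rw [h5, map_add, map_sum]
  simp only [map_smul, smul_eq_mul, h4]
  congr 1
  exact Finset.sum_congr rfl fun l _ => mul_comm _ _

/-- The algebra behind `∂_t (a - b) = a_p · d_x(a - b)` along the Hamilton-Jacobi flow of `a`, for
Poisson commuting functions `a` and `b`. -/
theorem transport_identity (ax ap bx bp T : Fin d → ℝ) (h : Fin d → Fin d → ℝ)
    (hsymm : ∀ k l, h k l = h l k) (hbr : ∑ k, (ax k * bp k - ap k * bx k) = 0) :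
    ∑ k, (ap k - bp k) * T k =
      ∑ k, ap k * (ax k + ∑ l, ap l * h k l - (bx k + ∑ l, bp l * h k l)) +
      ∑ k, (ap k - bp k) * (T k - (ax k + ∑ l, ap l * h k l)) := by
  -- The symmetry of the Hessian h cancels the second-order terms; what remains is the bracket.
  have e : ∑ k, bp k * ∑ l, ap l * h k l = ∑ k, ap k * ∑ l, bp l * h k l := by
    simp_rw [Finset.mul_sum]
    rw [Finset.sum_comm]
    refine Finset.sum_congr rfl fun k _ => Finset.sum_congr rfl fun l _ => ?_
    rw [hsymm l k]; ring
  rw [← sub_eq_zero, ← Finset.sum_add_distrib, ← Finset.sum_sub_distrib]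
  calc _ = ∑ k, (-(ax k * bp k - ap k * bx k)
        + (ap k * (∑ l, bp l * h k l) - bp k * ∑ l, ap l * h k l)) :=
        Finset.sum_congr rfl fun k _ => by ring
    _ = 0 := by
      rw [Finset.sum_add_distrib, Finset.sum_neg_distrib, hbr, Finset.sum_sub_distrib, e]
      simp

theorem SmoothAtZero.comp_graph {g : Coord d × Coord d → ℝ} {σ : ℝ × Coord d → Coord d}
    (hg : ∀ x, ContDiffAt ℝ ∞ g (x, 0)) (hσ : SmoothAtZero σ) (h0 : ∀ x, σ (0, x) = 0) :
    SmoothAtZero (fun z => g (z.2, σ z)) := fun x => by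
  refine ContDiffAt.comp (0, x) (f := fun z : ℝ × Coord d => (z.2, σ z)) ?_
    (contDiffAt_snd.prodMk (hσ x))
  rw [h0]
  exact hg x

theorem jet_mul_eq_zero {u v : ℝ × Coord d → ℝ} (hu : SmoothAtZero u) (hv : SmoothAtZero v)
    {m : ℕ} {x : Coord d} (h : ∀ j ≤ m, jet j v x = 0) : jet m (fun z => u z * v z) x = 0 :=
  iteratedDeriv_mul_eq_zero (contDiffAt_slice (hu x)) (contDiffAt_slice (hv x)) h

theorem jet_add {u v : ℝ × Coord d → ℝ} (hu : SmoothAtZero u) (hv : SmoothAtZero v)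
    (m : ℕ) (x : Coord d) : jet m (fun z => u z + v z) x = jet m u x + jet m v x := by
  have hm : ((m : ℕ) : ℕ∞ω) ≤ ∞ := by norm_cast; exact le_top
  exact iteratedDeriv_fun_add ((contDiffAt_slice (hu x)).of_le hm)
    ((contDiffAt_slice (hv x)).of_le hm)

theorem jet_sub {u v : ℝ × Coord d → ℝ} (hu : SmoothAtZero u) (hv : SmoothAtZero v)
    (m : ℕ) (x : Coord d) : jet m (fun z => u z - v z) x = jet m u x - jet m v x := by
  have hm : ((m : ℕ) : ℕ∞ω) ≤ ∞ := by norm_cast; exact le_top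
  exact iteratedDeriv_fun_sub ((contDiffAt_slice (hu x)).of_le hm)
    ((contDiffAt_slice (hv x)).of_le hm)

theorem jet_sum {ι : Type*} {s : Finset ι} {u : ι → ℝ × Coord d → ℝ}
    (hu : ∀ i, SmoothAtZero (u i)) (m : ℕ) (x : Coord d) :
    jet m (fun z => ∑ i ∈ s, u i z) x = ∑ i ∈ s, jet m (u i) x := by
  have hm : ((m : ℕ) : ℕ∞ω) ≤ ∞ := by norm_cast; exact le_top
  exact iteratedDeriv_fun_sum fun i _ => (contDiffAt_slice (hu i x)).of_le hm

/-- If `S` solves the Hamilton-Jacobi equation of `a` up to order `m` and `b` Poisson commutes with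
`a` and agrees with it on the zero section, then `a` and `b` agree on `graph(dS)` up to order
`m`. -/
theorem jet_sub_comp_graph_eq_zero {a b : Coord d × Coord d → ℝ} {S : ℝ × Coord d → ℝ}
    {σ : ℝ × Coord d → Coord d} {m : ℕ}
    (ha : ∀ x, ContDiffAt ℝ ∞ a (x, 0)) (hb : ∀ x, ContDiffAt ℝ ∞ b (x, 0))
    (hab : ∀ x, a (x, 0) = b (x, 0))
    (hbr : ∀ x, ∀ᶠ z in 𝓝 (x, 0), canonicalBracket a b z = 0)
    (hS : SmoothAtZero S) (hσ : SmoothAtZero σ)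
    (hσS : ∀ l z, σ z l = dirDeriv (0, Pi.single l 1) S z)
    (h0 : ∀ x, σ (0, x) = 0)
    (hHJ : ∀ j < m, ∀ x, jet j (dirDeriv (1, 0) S) x = jet j (fun z => a (z.2, σ z)) x)
    {j : ℕ} (hj : j ≤ m) :
    jet j (fun z => a (z.2, σ z) - b (z.2, σ z)) = 0 := by
  set A : ℝ × Coord d → ℝ := fun z => a (z.2, σ z) with hAdef
  set B : ℝ × Coord d → ℝ := fun z => b (z.2, σ z) with hBdef
  set D : ℝ × Coord d → ℝ := fun z => A z - B z with hDdef
  have hA : SmoothAtZero A := SmoothAtZero.comp_graph ha hσ h0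
  have hB : SmoothAtZero B := SmoothAtZero.comp_graph hb hσ h0
  have hD : SmoothAtZero D := fun x => (hA x).sub (hB x)
  set R : ℝ × Coord d → ℝ := fun z => dirDeriv (1, 0) S z - A z with hRdef
  have hR : SmoothAtZero R := fun x => (hS.dirDeriv _ x).sub (hA x)
  have hRjet : ∀ i < m, jet i R = 0 := fun i hi => by
    funext x
    rw [hRdef, jet_sub (hS.dirDeriv _) hA, hHJ i hi x, sub_self]
    rfl
  let ap : Fin d → ℝ × Coord d → ℝ := fun k z => dirDeriv (0, Pi.single k 1) a (z.2, σ z)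
  let bp : Fin d → ℝ × Coord d → ℝ := fun k z => dirDeriv (0, Pi.single k 1) b (z.2, σ z)
  have hdir : ∀ {g : Coord d × Coord d → ℝ} (_ : ∀ x, ContDiffAt ℝ ∞ g (x, 0)) (v),
      ∀ x, ContDiffAt ℝ ∞ (dirDeriv v g) (x, 0) := fun hg v x =>
    ((hg x).fderiv_right (m := ∞) (by simp)).clm_apply contDiffAt_const
  have hap : ∀ k, SmoothAtZero (ap k) := fun k => SmoothAtZero.comp_graph (hdir ha _) hσ h0
  have hbp : ∀ k, SmoothAtZero (bp k) := fun k => SmoothAtZero.comp_graph (hdir hb _) hσ h0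
  -- The transport equation: ∂_t D = a_p · ∂_x D + (a_p - b_p) · ∂_x R, with R = ∂_t S - A the
  -- residual of the Hamilton-Jacobi equation.
  have key : ∀ x, dirDeriv (1, 0) D =ᶠ[𝓝 (0, x)] fun z =>
      (∑ k, ap k z * dirDeriv (0, Pi.single k 1) D z) +
        ∑ k, (ap k z - bp k z) * dirDeriv (0, Pi.single k 1) R z := by
    intro x
    have hcont : Tendsto (fun z : ℝ × Coord d => (z.2, σ z)) (𝓝 (0, x)) (𝓝 (x, 0)) := by
      have : ContinuousAt (fun z : ℝ × Coord d => (z.2, σ z)) (0, x) :=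
        continuousAt_snd.prodMk (hσ x).continuousAt
      simpa [ContinuousAt, h0] using this
    have hdiff : ∀ {g : Coord d × Coord d → ℝ} (_ : ∀ x, ContDiffAt ℝ ∞ g (x, 0)),
        ∀ᶠ z in 𝓝 (x, (0 : Coord d)), DifferentiableAt ℝ g z := fun hg => by
      have h1 : ContDiffAt ℝ 1 _ (x, (0 : Coord d)) := (hg x).of_le (by norm_cast)
      filter_upwards [h1.eventually (by simp)] with z hz using hz.differentiableAt (by simp)
    have hsymm : ∀ᶠ z in 𝓝 ((0 : ℝ), x), ∀ k l : Fin d,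
        dirDeriv (0, Pi.single k 1) (dirDeriv (0, Pi.single l 1) S) z =
          dirDeriv (0, Pi.single l 1) (dirDeriv (0, Pi.single k 1) S) z :=
      eventually_all.2 fun k => eventually_all.2 fun l => dirDeriv_comm hS _ _ x
    have hmix : ∀ᶠ z in 𝓝 ((0 : ℝ), x), ∀ k : Fin d,
        dirDeriv (0, Pi.single k 1) (dirDeriv (1, 0) S) z =
          dirDeriv (1, 0) (dirDeriv (0, Pi.single k 1) S) z :=
      eventually_all.2 fun k => dirDeriv_comm hS _ _ x
    filter_upwards [hcont.eventually (hdiff ha), hcont.eventually (hdiff hb),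
      hcont.eventually (hbr x), hσ.eventually_differentiableAt x, hsymm, hmix,
      hA.eventually_differentiableAt x, hB.eventually_differentiableAt x,
      (hS.dirDeriv (1, 0)).eventually_differentiableAt x]
      with z hza hzb hzbr hzσ hzs hzm hzA hzB hzS
    have eD : ∀ w, dirDeriv w D z = dirDeriv w A z - dirDeriv w B z := fun w => by
      change fderiv ℝ (fun z => A z - B z) z w = _
      rw [fderiv_fun_sub hzA hzB]; rfl
    have eR : ∀ w, dirDeriv w R z = dirDeriv w (dirDeriv (1, 0) S) z - dirDeriv w A z := fun w => by
      change fderiv ℝ (fun z => dirDeriv (1, 0) S z - A z) z w = _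
      rw [fderiv_fun_sub hzS hzA]; rfl
    have eA := dirDeriv_comp_graph hza hzσ
    have eB := dirDeriv_comp_graph hzb hzσ
    have eσ : ∀ l, (fun z => σ z l) = dirDeriv (0, Pi.single l 1) S := fun l => funext (hσS l)
    have z0 : ∀ g : Coord d × Coord d → ℝ, dirDeriv (0, 0) g (z.2, σ z) = 0 := fun g => by
      simp [dirDeriv, Prod.mk_zero_zero]
    simp only [eD, eR]
    simp only [hAdef, hBdef, eA, eB, eσ, z0, hzm, zero_add, ← Finset.sum_sub_distrib, ← sub_mul]
    rw [transport_identity (fun k => dirDeriv (Pi.single k 1, 0) a (z.2, σ z))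
      (fun k => ap k z) (fun k => dirDeriv (Pi.single k 1, 0) b (z.2, σ z)) (fun k => bp k z)
      (fun k => dirDeriv (1, 0) (dirDeriv (0, Pi.single k 1) S) z)
      (fun k l => dirDeriv (0, Pi.single k 1) (dirDeriv (0, Pi.single l 1) S) z) hzs hzbr]
  induction j using Nat.strong_induction_on with
  | _ j ih =>
    funext x
    cases j with
    | zero => simp [jet_zero, hDdef, hAdef, hBdef, h0, hab]
    | succ j =>
      have s1 : ∀ k, SmoothAtZero fun z => ap k z * dirDeriv (0, Pi.single k 1) D z :=
        fun k y => (hap k y).mul (hD.dirDeriv _ y)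
      have s2 : ∀ k, SmoothAtZero fun z => (ap k z - bp k z) * dirDeriv (0, Pi.single k 1) R z :=
        fun k y => ((hap k y).sub (hbp k y)).mul (hR.dirDeriv _ y)
      -- Coefficient j + 1 of D is coefficient j of ∂_t D. It involves coefficients of order at most
      -- j of ∂_x D, zero by induction, and of ∂_x R, zero because j < m.
      rw [jet_succ hD, jet_congr (key x),
        jet_add (fun y => ContDiffAt.sum fun k _ => s1 k y)
          (fun y => ContDiffAt.sum fun k _ => s2 k y), jet_sum s1, jet_sum s2]
      have t1 : ∀ k, jet j (fun z => ap k z * dirDeriv (0, Pi.single k 1) D z) x = 0 := fun k =>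
        jet_mul_eq_zero (hap k) (hD.dirDeriv _) fun i hi => by
          rw [← fderiv_jet hD, ih i (by omega) (by omega)]
          simp
      have t2 : ∀ k, jet j (fun z => (ap k z - bp k z) * dirDeriv (0, Pi.single k 1) R z) x = 0 :=
        fun k => jet_mul_eq_zero (fun y => (hap k y).sub (hbp k y)) (hR.dirDeriv _) fun i hi => by
          rw [← fderiv_jet hR, hRjet i (by omega)]
          simp
      simp [t1, t2]

variable {α : ℝ → Coord d → Coord d → Coord d} {H : Coord d → ℝ}

/-- The generating function `Ŝ` has no terms of even order in `h`. -/
theorem hjCoef_even_eq_zero (hs : SmoothAtSection α H) (ε : ℝ)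
    (hbr : ∀ x, ∀ᶠ z in 𝓝 (x, (0 : Coord d)),
      canonicalBracket (fun z => H (α ε z.1 z.2)) (fun z => H (α ε z.1 (-z.2))) z = 0)
    (l : ℕ) (hl : Even l) : hjCoef α H ε 0 l = 0 := by
  induction l using Nat.strong_induction_on with
  | _ l ih =>
    cases l with
    | zero => rfl
    | succ m =>
      have hm : Odd m := by
        rw [← Nat.not_even_iff_odd]
        exact Nat.even_add_one.1 hl
      set S : ℝ × Coord d → ℝ := fun z => hjTrunc α H ε 0 m z.1 z.2 with hSdef
      have hSc : ContDiff ℝ ∞ S := contDiff_hjTrunc_fixed hs ε m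
      have hS : SmoothAtZero S := fun x => hSc.contDiffAt
      -- By induction the even coefficients up to order m vanish, so this truncation is odd in t.
      have hodd : ∀ t x, S (-t, x) = - S (t, x) := by
        intro t x
        simp only [hSdef, hjTrunc_eq_sum, ← Finset.sum_neg_distrib]
        refine Finset.sum_congr rfl fun k hk => ?_
        rcases Nat.even_or_odd k with h | h
        · have hk' : k < m + 1 := by simpa using hk
          simp [ih k hk' h]
        · rw [h.neg_pow]; ring
      set σ : ℝ × Coord d → Coord d := fun z => differential (fun y => S (z.1, y)) z.2 with hσdef
      have hσ : SmoothAtZero σ := fun x => contDiffAt_differential (hS x)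
      have hσ0 : ∀ x, σ (0, x) = 0 := fun x => differential_hjTrunc_zero_right ε 0 m x
      have hσodd : ∀ t x, σ (-t, x) = - σ (t, x) := by
        intro t x
        funext i
        simp only [hσdef, hodd, differential, Pi.neg_apply]
        rw [fderiv_fun_neg]
        rfl
      have hα : ∀ x, ContDiffAt ℝ ∞ (fun z : Coord d × Coord d => H (α ε z.1 z.2)) (x, 0) := fun x =>
        ContDiffAt.comp (x, 0) (f := fun z : Coord d × Coord d => (ε, z.1, z.2))
          (g := fun w : ℝ × Coord d × Coord d => H (α w.1 w.2.1 w.2.2)) (hs ε x) (by fun_prop)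
      have hβ : ∀ x, ContDiffAt ℝ ∞ (fun z : Coord d × Coord d => H (α ε z.1 (-z.2))) (x, 0) :=
        fun x => ContDiffAt.comp (x, 0) (f := fun z : Coord d × Coord d => (z.1, -z.2))
          (g := fun z : Coord d × Coord d => H (α ε z.1 z.2)) (by simpa using hα x) (by fun_prop)
      have hrhs : ∀ j ≤ m, ∀ x, hjCoef α H ε 0 (j + 1) x =
          jet j (fun z : ℝ × Coord d => H (α ε z.2 (σ z))) x := by
        intro j hj x
        have := iteratedDeriv_rhs_congr hs ε
          (S := fun z => hjTrunc α H ε 0 j z.1 z.2) (R := S)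
          (fun x => (contDiff_hjTrunc_fixed hs ε j).contDiffAt) hS j x
          (fun y => hjTrunc_zero_right ε 0 j y) (fun i hi => by
            funext y
            rw [hSdef, jet_hjTrunc, jet_hjTrunc, if_pos (by omega), if_pos (by omega)])
        simp only [hjCoef, Pi.zero_apply, add_zero]
        exact this
      have hD := jet_sub_comp_graph_eq_zero (m := m) (j := m) hα hβ (by simp) hbr hS hσ
        (fun l z => fderiv_slice (hSc.differentiable (by simp)).differentiableAt _) hσ0
        (fun j hj x => by
          rw [← jet_succ hS, ← hrhs j hj.le, hSdef, jet_hjTrunc, if_pos (by omega)]) le_rfl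
      funext x
      have hA := SmoothAtZero.comp_graph hα hσ hσ0
      have hB := SmoothAtZero.comp_graph hβ hσ hσ0
      have h1 := congrFun hD x
      rw [jet_sub hA hB] at h1
      -- On the graph, b is a evaluated at -σ(t) = σ(-t), so its m-th coefficient is (-1)^m = -1
      -- times that of a. As `hD` makes the two equal, both are zero.
      have h2 : jet m (fun z : ℝ × Coord d => H (α ε z.2 (-σ z))) x =
          - jet m (fun z : ℝ × Coord d => H (α ε z.2 (σ z))) x := by
        simp only [jet, ← hσodd]
        rw [iteratedDeriv_comp_neg m (fun t => H (α ε x (σ (t, x)))) 0, hm.neg_one_pow]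
        simp
      simp only at h1
      rw [h2] at h1
      rw [hrhs m le_rfl x]
      simp only [Pi.zero_apply] at h1 ⊢
      linarith

theorem differential_hjTrunc_neg (hs : SmoothAtSection α H) (ε : ℝ)
    (hbr : ∀ x, ∀ᶠ z in 𝓝 (x, (0 : Coord d)),
      canonicalBracket (fun z => H (α ε z.1 z.2)) (fun z => H (α ε z.1 (-z.2))) z = 0)
    {c : ℝ → ℝ} (hc : ContDiff ℝ ∞ c) (m : ℕ) (h : ℝ) (x : Coord d) :
    differential (hjTrunc α H ε c m (-h)) x = - differential (hjTrunc α H ε c m h) x := by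
  rw [differential_hjTrunc hs ε hc, differential_hjTrunc hs ε hc]
  have hodd : hjTrunc α H ε 0 m (-h) = fun y => -hjTrunc α H ε 0 m h y := by
    funext y
    simp only [hjTrunc_eq_sum, ← Finset.sum_neg_distrib]
    refine Finset.sum_congr rfl fun k _ => ?_
    rcases Nat.even_or_odd k with h | h
    · simp [hjCoef_even_eq_zero hs ε hbr k h]
    · rw [h.neg_pow]; ring
  funext i
  rw [hodd]
  simp only [differential, Pi.neg_apply]
  rw [fderiv_fun_neg]
  rfl

end Oddness

/-! ### Smoothness of composition operators on spaces of continuous functions -/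

section Nemytskii

variable {K : Type} [TopologicalSpace K] [CompactSpace K]
  {E F : Type} [NormedAddCommGroup E] [NormedSpace ℝ E] [NormedAddCommGroup F] [NormedSpace ℝ F]

/-- Pointwise application `(A, h) ↦ (t ↦ A(t) h(t))` of continuous families of operators. -/
noncomputable def pointwiseApply : C(K, E →L[ℝ] F) →L[ℝ] C(K, E) →L[ℝ] C(K, F) :=
  LinearMap.mkContinuous₂
    (LinearMap.mk₂ ℝ
      (fun (A : C(K, E →L[ℝ] F)) (h : C(K, E)) => (⟨fun t => A t (h t), by fun_prop⟩ : C(K, F)))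
      (fun A B h => by ext t; simp) (fun r A h => by ext t; simp)
      (fun A h k => by ext t; simp) (fun r A h => by ext t; simp))
    1 (fun A h => by
      rw [ContinuousMap.norm_le _ (by positivity), one_mul]
      intro t
      exact (A t).le_of_opNorm_le_of_le (A.norm_coe_le_norm t) (h.norm_coe_le_norm t))

theorem pointwiseApply_apply (A : C(K, E →L[ℝ] F)) (h : C(K, E)) (t : K) :
    pointwiseApply A h t = A t (h t) := rfl

/-- The range of u is compact, so g' varies little near it, uniformly along the range; the mean
value inequality then bounds the remainder by c‖h‖ for all t at once. -/
theorem hasFDerivAt_postcomp {g : C(E, F)} {g' : C(E, E →L[ℝ] F)}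
    (hg : ∀ x, HasFDerivAt g (g' x) x) (u : C(K, E)) :
    HasFDerivAt (fun u : C(K, E) => g.comp u) (pointwiseApply (g'.comp u)) u := by
  rw [hasFDerivAt_iff_isLittleO_nhds_zero, Asymptotics.isLittleO_iff]
  intro c hc
  have hK : IsCompact (Set.range u) := isCompact_range u.continuous
  have hu := hK.uniformContinuousAt_of_continuousAt g' (fun a _ => g'.continuous.continuousAt)
    (Metric.dist_mem_uniformity hc)
  obtain ⟨δ, hδ, hsub⟩ := Metric.mem_uniformity_dist.1 hu
  filter_upwards [Metric.ball_mem_nhds (0 : C(K, E)) hδ] with h hh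
  rw [mem_ball_zero_iff] at hh
  rw [ContinuousMap.norm_le _ (by positivity)]
  intro t
  have hht : ‖h t‖ ≤ ‖h‖ := h.norm_coe_le_norm t
  have key := (convex_ball (u t) δ).norm_image_sub_le_of_norm_hasFDerivWithin_le'
    (f := g) (f' := g') (φ := g' (u t)) (C := c) (x := u t) (y := u t + h t)
    (fun x _ => (hg x).hasFDerivWithinAt)
    (fun x hx => by
      have := hsub (a := u t) (b := x) (by rw [dist_comm]; exact hx) ⟨t, rfl⟩
      rw [← dist_eq_norm, dist_comm]
      exact le_of_lt this)
    (Metric.mem_ball_self hδ) (by rw [Metric.mem_ball, dist_eq_norm]; simpa using hht.trans_lt hh)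
  rw [add_sub_cancel_left] at key
  exact key.trans (by gcongr)

/-- The target F is quantified inside the induction, which passes from g to its derivative with
values in E →L[ℝ] F. -/
theorem contDiff_nat_postcomp (n : ℕ) :
    ∀ {F : Type} [NormedAddCommGroup F] [NormedSpace ℝ F] (g : C(E, F)), ContDiff ℝ n g →
      ContDiff ℝ n (fun u : C(K, E) => g.comp u) := by
  induction n with
  | zero =>
    intro F _ _ g _
    simpa using! g.continuous_postcomp
  | succ n ih =>
    intro F _ _ g hg
    rw [Nat.cast_succ, contDiff_succ_iff_hasFDerivAt] at hg ⊢
    obtain ⟨g', hg', hd⟩ := hg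
    let G : C(E, E →L[ℝ] F) := ⟨g', hg'.continuous⟩
    have hL : ContDiff ℝ n (fun A : C(K, E →L[ℝ] F) => pointwiseApply A) :=
      ContinuousLinearMap.contDiff _
    exact ⟨fun u => pointwiseApply (G.comp u), hL.comp (ih G hg'),
      hasFDerivAt_postcomp (g' := G) hd⟩

/-- Composition with a smooth map is a smooth map of spaces of continuous functions. -/
theorem contDiff_postcomp (g : C(E, F)) (hg : ContDiff ℝ ∞ g) :
    ContDiff ℝ ∞ (fun u : C(K, E) => g.comp u) :=
  contDiff_infty.2 fun n => contDiff_nat_postcomp n g (contDiff_infty.1 hg n)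

end Nemytskii

/-! ### Paths with prescribed mean, by the inverse function theorem -/

section IntegralEquation

open unitInterval

variable {E : Type} [NormedAddCommGroup E] [NormedSpace ℝ E]

/-- The extension of a path on `[0, 1]` to `ℝ`, constant outside `[0, 1]`. -/
noncomputable def pathExt (u : C(I, E)) : ℝ → E := Set.IccExtend zero_le_one u

theorem continuous_pathExt (u : C(I, E)) : Continuous (pathExt u) := u.continuous.Icc_extend'

theorem pathExt_apply (u : C(I, E)) (t : I) : pathExt u t = u t := Set.IccExtend_val _ _ _

theorem norm_pathExt_le (u : C(I, E)) (t : ℝ) : ‖pathExt u t‖ ≤ ‖u‖ := u.norm_coe_le_norm _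

theorem norm_integral_pathExt_le (u : C(I, E)) (t : I) :
    ‖∫ s in (0 : ℝ)..t, pathExt u s‖ ≤ ‖u‖ := by
  have h := intervalIntegral.norm_integral_le_of_norm_le_const (a := (0 : ℝ)) (b := t)
    (fun s _ => norm_pathExt_le u s)
  refine h.trans (mul_le_of_le_one_right (norm_nonneg _) ?_)
  rw [sub_zero, abs_of_nonneg t.2.1]
  exact t.2.2

/-- The primitive vanishing at `0`. -/
noncomputable def primitive : C(I, E) →L[ℝ] C(I, E) :=
  LinearMap.mkContinuous
    { toFun := fun u => ⟨fun t => ∫ s in (0 : ℝ)..t, pathExt u s,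
        (intervalIntegral.continuous_primitive
          (fun a b => (continuous_pathExt u).intervalIntegrable a b) 0).comp continuous_subtype_val⟩
      map_add' := fun u v => by
        ext t
        exact intervalIntegral.integral_add ((continuous_pathExt u).intervalIntegrable _ _)
          ((continuous_pathExt v).intervalIntegrable _ _)
      map_smul' := fun r u => by
        ext t
        exact intervalIntegral.integral_smul r _ }
    1 (fun u => by
      rw [ContinuousMap.norm_le _ (by positivity), one_mul]
      exact norm_integral_pathExt_le u)

theorem primitive_apply (u : C(I, E)) (t : I) :
    primitive u t = ∫ s in (0 : ℝ)..t, pathExt u s := rfl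

/-- The mean of a path. -/
noncomputable def mean : C(I, E) →L[ℝ] E :=
  (ContinuousMap.evalCLM ℝ (1 : I)).comp primitive

theorem mean_apply (u : C(I, E)) : mean u = ∫ s in (0 : ℝ)..1, pathExt u s := rfl

/-- Constant paths. -/
noncomputable def constPath : E →L[ℝ] C(I, E) :=
  LinearMap.mkContinuous
    { toFun := fun x => ContinuousMap.const I x
      map_add' := fun _ _ => rfl
      map_smul' := fun _ _ => rfl }
    1 (fun x => by
      rw [ContinuousMap.norm_le _ (by positivity), one_mul]
      exact fun _ => le_rfl)

theorem constPath_apply (x : E) (t : I) : constPath x t = x := rfl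

theorem norm_constPath (x : E) : ‖constPath x‖ = ‖x‖ :=
  le_antisymm ((ContinuousMap.norm_le _ (norm_nonneg x)).2 fun _ => le_rfl)
    ((constPath x).norm_coe_le_norm 0)

theorem mean_constPath [CompleteSpace E] (x : E) : mean (constPath x) = x := by
  rw [mean_apply]
  have : pathExt (constPath x) = fun _ => x := rfl
  rw [this]
  simp

/-- The path `t ↦ (y(t), q)`. -/
noncomputable def pairPath : C(I, E) × E →L[ℝ] C(I, E × E) :=
  ((ContinuousLinearMap.inl ℝ E E).compLeftContinuous ℝ I).comp (ContinuousLinearMap.fst ℝ _ _) +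
    ((ContinuousLinearMap.inr ℝ E E).compLeftContinuous ℝ I).comp
      (constPath.comp (ContinuousLinearMap.snd ℝ _ _))

theorem pairPath_apply (y : C(I, E)) (q : E) (t : I) : pairPath (y, q) t = (y t, q) := by
  simp [pairPath, constPath_apply]

/-- The primitive with mean zero. -/
noncomputable def meanZeroPrimitive : C(I, E) →L[ℝ] C(I, E) :=
  primitive - constPath.comp (mean.comp primitive)

/-- The defect of the integral equation for a path `y` with `y' = w(y, q)` and mean `x`. -/
noncomputable def pathDefect (w : C(E × E, E)) (z : C(I, E) × (E × E)) : C(I, E) :=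
  z.1 - constPath z.2.1 - meanZeroPrimitive (w.comp (pairPath (z.1, z.2.2)))

/-- The linear map `(k, ξ, θ) ↦ (k, θ)`. -/
noncomputable def pathMomentum : C(I, E) × (E × E) →L[ℝ] C(I, E) × E :=
  (ContinuousLinearMap.fst ℝ _ _).prod
    ((ContinuousLinearMap.snd ℝ _ _).comp (ContinuousLinearMap.snd ℝ _ _))

/-- The derivative of `pathDefect`. -/
noncomputable def pathDefectDeriv (w' : C(E × E, E × E →L[ℝ] E)) (z : C(I, E) × (E × E)) :
    C(I, E) × (E × E) →L[ℝ] C(I, E) :=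
  ContinuousLinearMap.fst ℝ _ _
    - constPath.comp ((ContinuousLinearMap.fst ℝ _ _).comp (ContinuousLinearMap.snd ℝ _ _))
    - meanZeroPrimitive.comp
      ((pointwiseApply (w'.comp (pairPath (z.1, z.2.2)))).comp (pairPath.comp pathMomentum))

theorem hasFDerivAt_pathDefect {w : C(E × E, E)} {w' : C(E × E, E × E →L[ℝ] E)}
    (hw : ∀ x, HasFDerivAt w (w' x) x) (z : C(I, E) × (E × E)) :
    HasFDerivAt (pathDefect w) (pathDefectDeriv w' z) z := by
  have h1 : HasFDerivAt (fun z : C(I, E) × (E × E) => w.comp (pairPath (z.1, z.2.2)))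
      ((pointwiseApply (w'.comp (pairPath (z.1, z.2.2)))).comp (pairPath.comp pathMomentum)) z :=
    HasFDerivAt.comp (f := fun z : C(I, E) × (E × E) => pairPath (z.1, z.2.2)) z
      (hasFDerivAt_postcomp hw (pairPath (z.1, z.2.2)))
      ((pairPath (E := E)).comp pathMomentum).hasFDerivAt
  have h2 := meanZeroPrimitive.hasFDerivAt.comp z h1
  exact ((ContinuousLinearMap.fst ℝ _ _).hasFDerivAt.sub
    (constPath.comp ((ContinuousLinearMap.fst ℝ _ _).comp
      (ContinuousLinearMap.snd ℝ _ _))).hasFDerivAt).sub h2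

theorem contDiff_pathDefect {w : C(E × E, E)} (hw : ContDiff ℝ ∞ w) :
    ContDiff ℝ ∞ (pathDefect w) := by
  have h1 : ContDiff ℝ ∞ (fun z : C(I, E) × (E × E) => w.comp (pairPath (z.1, z.2.2))) :=
    (contDiff_postcomp w hw).comp ((pairPath (E := E)).comp pathMomentum).contDiff
  exact ((ContinuousLinearMap.fst ℝ _ _).contDiff.sub
    (constPath.comp ((ContinuousLinearMap.fst ℝ _ _).comp
      (ContinuousLinearMap.snd ℝ _ _))).contDiff).sub (meanZeroPrimitive.contDiff.comp h1)

theorem pathDefect_constPath {w : C(E × E, E)} (hw0 : ∀ x, w (x, 0) = 0) (x : E) :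
    pathDefect w (constPath x, x, 0) = 0 := by
  have : w.comp (pairPath (constPath x, 0)) = 0 := by
    ext t
    rw [ContinuousMap.comp_apply, pairPath_apply, hw0]
    rfl
  simp [pathDefect, this]

/-- Near a constant path and `q = 0` the integral equation has a unique solution, which depends
smoothly on `(x, q)`. -/
theorem exists_local_path [CompleteSpace E] {w : C(E × E, E)} (hw : ContDiff ℝ ∞ w)
    (hw0 : ∀ x, w (x, 0) = 0) (x₀ : E) :
    ∃ r > 0, ∃ ρ > 0, ρ ≤ r / 4 ∧ ∃ Y : E × E → C(I, E),
      ContDiffOn ℝ ∞ Y (Metric.ball (x₀, 0) ρ) ∧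
      (∀ v ∈ Metric.ball (x₀, 0) ρ, ‖Y v - constPath x₀‖ < r / 4 ∧ pathDefect w (Y v, v) = 0) ∧
      ∀ v ∈ Metric.ball (x₀, (0 : E)) r, ∀ y y' : C(I, E), ‖y - constPath x₀‖ < r →
        ‖y' - constPath x₀‖ < r → pathDefect w (y, v) = 0 → pathDefect w (y', v) = 0 → y = y' := by
  let w' : C(E × E, E × E →L[ℝ] E) := ⟨fderiv ℝ w, hw.continuous_fderiv (by simp)⟩
  have hw' : ∀ x, HasFDerivAt w (w' x) x := fun x =>
    (hw.differentiable (by simp) x).hasFDerivAt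
  -- Keeping the parameters as a second component turns the implicit equation into an inversion
  -- problem.
  let Φ : C(I, E) × (E × E) → C(I, E) × (E × E) := fun z => (pathDefect w z, z.2)
  have hΦ : ContDiff ℝ ∞ Φ := (contDiff_pathDefect hw).prodMk contDiff_snd
  let b : C(I, E) × (E × E) := (constPath x₀, x₀, 0)
  have hΦb : Φ b = (0, x₀, 0) := Prod.ext (pathDefect_constPath hw0 x₀) rfl
  let N : E × E →L[ℝ] C(I, E) :=
    -(pathDefectDeriv w' b).comp (ContinuousLinearMap.inr ℝ (C(I, E)) (E × E))
  have hN : ∀ z, pathDefectDeriv w' b z = z.1 - N z.2 := by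
    rintro ⟨k, v⟩
    have h1 : pathDefectDeriv w' b (k, 0) = k := by
      -- Since w(·, 0) = 0, the y-derivative of w vanishes at q = 0, and the defect has derivative
      -- the identity in the path direction.
      have h2 : pointwiseApply (w'.comp (pairPath (constPath x₀, 0))) (pairPath (k, 0)) = 0 := by
        ext t
        rw [pointwiseApply_apply, pairPath_apply, ContinuousMap.comp_apply, pairPath_apply]
        have h3 : HasFDerivAt (fun x : E => w (x, 0))
            ((w' (x₀, 0)).comp (ContinuousLinearMap.inl ℝ E E)) x₀ :=
          (hw' (x₀, 0)).comp x₀ (hasFDerivAt_prodMk_left x₀ 0)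
        have h4 : HasFDerivAt (fun x : E => w (x, 0)) (0 : E →L[ℝ] E) x₀ := by
          simp only [hw0]
          exact hasFDerivAt_const _ _
        exact congrArg (fun L : E →L[ℝ] E => L (k t)) (h3.unique h4)
      simp [pathDefectDeriv, pathMomentum, b, h2]
    have h5 : ((k, v) : C(I, E) × (E × E)) = (k, 0) + (0, v) := by simp
    rw [h5, map_add, h1]
    simp [N]
  let e : (C(I, E) × (E × E)) ≃L[ℝ] C(I, E) × (E × E) :=
    ContinuousLinearEquiv.equivOfInverse
      ((ContinuousLinearMap.fst ℝ _ _ - N.comp (ContinuousLinearMap.snd ℝ _ _)).prod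
        (ContinuousLinearMap.snd ℝ _ _))
      ((ContinuousLinearMap.fst ℝ _ _ + N.comp (ContinuousLinearMap.snd ℝ _ _)).prod
        (ContinuousLinearMap.snd ℝ _ _))
      (fun z => by simp) (fun z => by simp)
  have hder : HasFDerivAt Φ (e : C(I, E) × (E × E) →L[ℝ] C(I, E) × (E × E)) b := by
    have h1 := (hasFDerivAt_pathDefect hw' b).prodMk
      (hasFDerivAt_snd (𝕜 := ℝ) (p := b))
    have h2 : (e : C(I, E) × (E × E) →L[ℝ] C(I, E) × (E × E)) =
        (pathDefectDeriv w' b).prod (ContinuousLinearMap.snd ℝ _ _) :=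
      ContinuousLinearMap.ext fun z => Prod.ext (hN z).symm rfl
    rw [h2]
    exact h1
  have hn : (∞ : ℕ∞ω) ≠ 0 := by simp
  let Ψ := hΦ.contDiffAt.toOpenPartialHomeomorph Φ hder hn
  have hΨ : ∀ z, Ψ z = Φ z := fun _ => rfl
  have hbs : b ∈ Ψ.source := hΦ.contDiffAt.mem_toOpenPartialHomeomorph_source hder hn
  -- Invertible operators form an open set, so the derivative is invertible on a whole ball and the
  -- local inverse is smooth beyond the base point.
  have hinv : ∀ᶠ z in 𝓝 b, fderiv ℝ Φ z ∈
      Set.range ((↑) : ((C(I, E) × (E × E)) ≃L[ℝ] C(I, E) × (E × E)) → _) :=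
    (hΦ.continuous_fderiv (by simp)).continuousAt.eventually_mem
      (ContinuousLinearEquiv.isOpen.mem_nhds ⟨e, hder.fderiv.symm⟩)
  obtain ⟨r, hr, hball⟩ := Metric.eventually_nhds_iff_ball.1
    (hinv.and (Ψ.open_source.eventually_mem hbs))
  have hbt : ((0 : C(I, E)), x₀, (0 : E)) ∈ Ψ.target := by
    rw [← hΦb]; exact Ψ.map_source hbs
  have hsymm : Ψ.symm (0, x₀, 0) = b := by
    rw [← hΦb]; exact Ψ.left_inv hbs
  have hev : ∀ᶠ v in 𝓝 (x₀, (0 : E)), ((0 : C(I, E)), v) ∈ Ψ.target ∧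
      Ψ.symm (0, v) ∈ Metric.ball b (r / 4) := by
    have hc : ContinuousAt (fun v : E × E => ((0 : C(I, E)), v)) (x₀, 0) := by fun_prop
    refine (hc.eventually (Ψ.open_target.eventually_mem hbt)).and ?_
    have h1 : Tendsto Ψ.symm (𝓝 (0, x₀, 0)) (𝓝 b) := by
      have := Ψ.symm.continuousAt hbt
      rwa [ContinuousAt, hsymm] at this
    exact hc.eventually (h1.eventually_mem (Metric.ball_mem_nhds b (by positivity)))
  obtain ⟨ρ', hρ', hρball⟩ := Metric.eventually_nhds_iff_ball.1 hev
  have hsol : ∀ v ∈ Metric.ball (x₀, (0 : E)) ρ', pathDefect w ((Ψ.symm (0, v)).1, v) = 0 := by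
    intro v hv
    have h1 : Φ (Ψ.symm (0, v)) = (0, v) := Ψ.right_inv (hρball v hv).1
    have h2 : (Ψ.symm (0, v)).2 = v := congrArg Prod.snd h1
    have h3 : pathDefect w (Ψ.symm (0, v)) = 0 := congrArg Prod.fst h1
    have h4 : ((Ψ.symm (0, v)).1, v) = Ψ.symm (0, v) := Prod.ext rfl h2.symm
    rw [h4, h3]
  -- Uniqueness holds at radius r while solutions lie within r / 4; the margin allows solutions with
  -- different centres to be compared.
  refine ⟨r, hr, min ρ' (r / 4), by positivity, min_le_right _ _, fun v => (Ψ.symm (0, v)).1,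
    ?_, ?_, ?_⟩
  · intro v hv
    have hv' := hρball v (Metric.ball_subset_ball (min_le_left _ _) hv)
    obtain ⟨e', he'⟩ := (hball _ (Metric.ball_subset_ball (by linarith) hv'.2)).1
    have h1 : HasFDerivAt Ψ (e' : C(I, E) × (E × E) →L[ℝ] C(I, E) × (E × E)) (Ψ.symm (0, v)) := by
      rw [he']
      exact (hΦ.differentiable (by simp) _).hasFDerivAt
    have h2 := Ψ.contDiffAt_symm hv'.1 h1 hΦ.contDiffAt
    have h3 : ContDiffAt ℝ ∞ (fun v : E × E => Ψ.symm (0, v)) v :=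
      h2.comp v (f := fun v : E × E => ((0 : C(I, E)), v)) (by fun_prop)
    exact h3.fst.contDiffWithinAt
  · intro v hv
    have hv1 := Metric.ball_subset_ball (min_le_left _ _) hv
    refine ⟨?_, hsol v hv1⟩
    have h1 := (hρball v hv1).2
    rw [Metric.mem_ball, dist_eq_norm] at h1
    exact (norm_fst_le _).trans_lt h1
  · intro v hv y y' hy hy' h1 h2
    have hmem : ∀ y : C(I, E), ‖y - constPath x₀‖ < r → (y, v) ∈ Ψ.source := by
      intro y hy
      refine (hball (y, v) ?_).2
      rw [Metric.mem_ball, Prod.dist_eq, max_lt_iff]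
      exact ⟨by rw [dist_eq_norm]; exact hy, hv⟩
    have h3 : Φ (y, v) = Φ (y', v) := Prod.ext (h1.trans h2.symm) rfl
    exact congrArg Prod.fst (Ψ.injOn (hmem y hy) (hmem y' hy') h3)

end IntegralEquation

/-! ### Zeros of the defect as solutions of the differential equation -/

section PathODE

open unitInterval

variable {E : Type} [NormedAddCommGroup E] [NormedSpace ℝ E] [CompleteSpace E]

theorem pathExt_of_mem (u : C(I, E)) {t : ℝ} (ht : t ∈ Set.Icc (0 : ℝ) 1) :
    pathExt u t = u ⟨t, ht⟩ := Set.IccExtend_of_mem _ _ ht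

theorem hasDerivWithinAt_pathExt {u g : C(I, E)} {a : E} (h : u = constPath a + primitive g)
    {t : ℝ} (ht : t ∈ Set.Icc (0 : ℝ) 1) :
    HasDerivWithinAt (pathExt u) (pathExt g t) (Set.Icc 0 1) t := by
  have h1 : HasDerivAt (fun t => a + ∫ s in (0 : ℝ)..t, pathExt g s) (pathExt g t) t :=
    ((continuous_pathExt g).integral_hasStrictDerivAt 0 t).hasDerivAt.const_add a
  refine h1.hasDerivWithinAt.congr (fun s hs => ?_) ?_ <;>
  · rw [pathExt_of_mem u (by assumption), h]
    rfl

theorem eq_constPath_add_primitive {u g : C(I, E)}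
    (h : ∀ t ∈ Set.Icc (0 : ℝ) 1, HasDerivWithinAt (pathExt u) (pathExt g t) (Set.Icc 0 1) t) :
    u = constPath (u 0) + primitive g := by
  ext t
  have h1 := intervalIntegral.integral_eq_sub_of_hasDerivAt_of_le (f := pathExt u)
    (f' := pathExt g) t.2.1 (continuous_pathExt u).continuousOn
    (fun s hs => (h s ⟨hs.1.le, hs.2.le.trans t.2.2⟩).hasDerivAt
      (Icc_mem_nhds hs.1 (hs.2.trans_le t.2.2)))
    ((continuous_pathExt g).intervalIntegrable _ _)
  rw [ContinuousMap.add_apply, constPath_apply, primitive_apply, h1, pathExt_apply,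
    pathExt_of_mem u (by simp)]
  exact (add_sub_cancel _ _).symm

/-- This lemma and the next two show that the zeros of `pathDefect` are exactly the solutions of y'
= w(y, q) on [0, 1] with mean x. The mean-zero primitive contributes nothing to the mean. -/
theorem mean_of_pathDefect_eq_zero {w : C(E × E, E)} {y : C(I, E)} {x q : E}
    (h : pathDefect w (y, x, q) = 0) : mean y = x := by
  have h1 : y = constPath x + meanZeroPrimitive (w.comp (pairPath (y, q))) := by
    rw [pathDefect, sub_sub, sub_eq_zero] at h
    exact h
  rw [h1, map_add, mean_constPath]
  simp [meanZeroPrimitive, mean_constPath]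

theorem hasDerivWithinAt_of_pathDefect_eq_zero {w : C(E × E, E)} {y : C(I, E)} {x q : E}
    (h : pathDefect w (y, x, q) = 0) {t : ℝ} (ht : t ∈ Set.Icc (0 : ℝ) 1) :
    HasDerivWithinAt (pathExt y) (w (pathExt y t, q)) (Set.Icc 0 1) t := by
  set g := w.comp (pairPath (y, q)) with hg
  have h1 : y = constPath (x - mean (primitive g)) + primitive g := by
    rw [pathDefect, sub_sub, sub_eq_zero] at h
    change y = constPath x + (primitive g - constPath (mean (primitive g))) at h
    rw [map_sub]
    exact h.trans (by abel)
  have h2 := hasDerivWithinAt_pathExt h1 ht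
  rwa [pathExt_of_mem g ht, hg, ContinuousMap.comp_apply, pairPath_apply,
    ← pathExt_of_mem y ht] at h2

theorem pathDefect_eq_zero {w : C(E × E, E)} {y : C(I, E)} {x q : E}
    (h : ∀ t ∈ Set.Icc (0 : ℝ) 1,
      HasDerivWithinAt (pathExt y) (w (pathExt y t, q)) (Set.Icc 0 1) t)
    (hx : mean y = x) : pathDefect w (y, x, q) = 0 := by
  set g := w.comp (pairPath (y, q)) with hg
  have h1 : y = constPath (y 0) + primitive g := by
    refine eq_constPath_add_primitive fun t ht => ?_
    rw [pathExt_of_mem g ht, hg, ContinuousMap.comp_apply, pairPath_apply, ← pathExt_of_mem y ht]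
    exact h t ht
  have h2 : x = y 0 + mean (primitive g) := by
    rw [← hx]
    nth_rewrite 1 [h1]
    rw [map_add, mean_constPath]
  change y - constPath x - (primitive g - constPath (mean (primitive g))) = 0
  rw [h2, map_add]
  nth_rewrite 1 [h1]
  abel

/-- Time reversal of paths. -/
noncomputable def revPath (y : C(I, E)) : C(I, E) := y.comp ⟨σ, continuous_symm⟩

theorem revPath_apply (y : C(I, E)) (t : I) : revPath y t = y (σ t) := rfl

theorem pathExt_revPath (y : C(I, E)) {t : ℝ} (ht : t ∈ Set.Icc (0 : ℝ) 1) :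
    pathExt (revPath y) t = pathExt y (1 - t) := by
  have ht' : 1 - t ∈ Set.Icc (0 : ℝ) 1 := ⟨by linarith [ht.2], by linarith [ht.1]⟩
  rw [pathExt_of_mem _ ht, pathExt_of_mem _ ht', revPath_apply]
  rfl

/-- Reversing time changes the sign of the velocity, which is absorbed by q ↦ -q, and preserves the
mean. This identifies β_ε with the final endpoint of the path that starts at α_ε. -/
theorem pathDefect_revPath {w : C(E × E, E)} (hw : ∀ y q, w (y, -q) = -w (y, q)) {y : C(I, E)}
    {x q : E} (h : pathDefect w (y, x, q) = 0) : pathDefect w (revPath y, x, -q) = 0 := by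
  have hrev : ∀ t ∈ Set.Icc (0 : ℝ) 1, 1 - t ∈ Set.Icc (0 : ℝ) 1 := fun t ht =>
    ⟨by linarith [ht.2], by linarith [ht.1]⟩
  refine pathDefect_eq_zero (fun t ht => ?_) ?_
  · have h1 := hasDerivWithinAt_of_pathDefect_eq_zero h (hrev t ht)
    have h2 : HasDerivWithinAt (fun t : ℝ => 1 - t) (-1) (Set.Icc 0 1) t := by
      simpa using (hasDerivWithinAt_id t (Set.Icc (0 : ℝ) 1)).const_sub 1
    have h3 := h1.scomp t h2 hrev
    rw [neg_one_smul, ← hw, ← pathExt_revPath y ht] at h3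
    exact h3.congr (fun s hs => pathExt_revPath y hs) (pathExt_revPath y ht)
  · rw [← mean_of_pathDefect_eq_zero h, mean_apply, mean_apply]
    have h4 : ∫ s in (0 : ℝ)..1, pathExt (revPath y) s = ∫ s in (0 : ℝ)..1, pathExt y (1 - s) := by
      refine intervalIntegral.integral_congr fun s hs => ?_
      rw [Set.uIcc_of_le zero_le_one] at hs
      exact pathExt_revPath y hs
    rw [h4, intervalIntegral.integral_comp_sub_left]
    simp

/-- A solution which starts near `x₀` stays near `x₀` if the velocity is small there. -/
theorem norm_sub_constPath_lt {w : C(E × E, E)} {y : C(I, E)} {x q x₀ : E} {r : ℝ}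
    (hr : 0 < r) (h : pathDefect w (y, x, q) = 0) (h0 : ‖y 0 - x₀‖ ≤ r / 4)
    (hw : ∀ v, ‖v - x₀‖ ≤ r → ‖w (v, q)‖ < r / 2) : ‖y - constPath x₀‖ < r := by
  have hd : ∀ t ∈ Set.Icc (0 : ℝ) 1, HasDerivWithinAt (fun t => pathExt y t - x₀)
      (w (pathExt y t, q)) (Set.Icc 0 1) t := fun t ht =>
    (hasDerivWithinAt_of_pathDefect_eq_zero h ht).sub_const x₀
  -- The comparison needs the velocity bound only at times when the norm equals r / 4 + (r / 2) t ≤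
  -- 3r / 4, where the path is still within distance r of x₀.
  have key := image_norm_le_of_norm_deriv_right_lt_deriv_boundary (a := 0) (b := 1)
    (f := fun t => pathExt y t - x₀) (f' := fun t => w (pathExt y t, q))
    (B := fun t => r / 4 + r / 2 * t) (B' := fun _ => r / 2)
    (fun t ht => (hd t ht).continuousWithinAt)
    (fun t ht => (hd t ⟨ht.1, ht.2.le⟩).mono_of_mem_nhdsWithin (Icc_mem_nhdsGE_of_mem ht))
    (by
      rw [pathExt_of_mem y (by simp)]
      simpa using h0)
    (fun t => by simpa using ((hasDerivAt_id t).const_mul (r / 2)).const_add (r / 4))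
    (fun t ht he => hw _ (by rw [he]; nlinarith [ht.1, ht.2]))
  refine lt_of_le_of_lt ((ContinuousMap.norm_le _ (by positivity : (0 : ℝ) ≤ 3 * r / 4)).2
    fun t => ?_) (by linarith : 3 * r / 4 < r)
  have := key t.2
  rw [pathExt_apply] at this
  exact this.trans (by nlinarith [t.2.1, t.2.2])

end PathODE

/-! ### Existence and local description of Karasev maps -/

section Karasev

open unitInterval

variable {d : ℕ} {π : Coord d → Matrix (Fin d) (Fin d) ℝ}

theorem contDiff_spray (hπ : ∀ i j, ContDiff ℝ ∞ (fun x => π x i j)) :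
    ContDiff ℝ ∞ (fun z : Coord d × Coord d => (spray π z).1) := by
  rw [contDiff_pi]
  intro j
  refine (ContDiff.sum fun i _ => ?_).neg
  exact ((hπ i j).comp contDiff_fst).mul (by fun_prop)

/-- The velocity `(y, q) ↦ -π^{ij}(y) q_i` of the spray. -/
noncomputable def velocity (hπ : ∀ i j, ContDiff ℝ ∞ (fun x => π x i j)) :
    C(Coord d × Coord d, Coord d) := ⟨fun z => (spray π z).1, (contDiff_spray hπ).continuous⟩

variable (hπ : ∀ i j, ContDiff ℝ ∞ (fun x => π x i j))

theorem velocity_apply (y q : Coord d) (j : Fin d) :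
    velocity hπ (y, q) j = -∑ i, π y i j * q i := rfl

theorem velocity_smul (y q : Coord d) (r : ℝ) :
    velocity hπ (y, r • q) = r • velocity hπ (y, q) := by
  funext j
  simp only [velocity_apply, Pi.smul_apply, smul_eq_mul, mul_neg, Finset.mul_sum]
  congr 1
  exact Finset.sum_congr rfl fun i _ => by ring

theorem velocity_zero (y : Coord d) : velocity hπ (y, 0) = 0 := by
  simpa using velocity_smul hπ y 0 0

theorem velocity_neg (y q : Coord d) : velocity hπ (y, -q) = -velocity hπ (y, q) := by
  simpa using velocity_smul hπ y q (-1)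

/-- The velocity is homogeneous in the momentum, so rescaling the time interval between 0 and ε to
[0, 1] replaces p by q = εp. -/
theorem isXAverage_of_pathDefect {ε : ℝ} {y : C(I, Coord d)} {x p : Coord d}
    (h : pathDefect (velocity hπ) (y, x, ε • p) = 0) (h0 : ε = 0 → y = constPath x) :
    IsXAverage π ε (y 0) p x := by
  have hy0 : pathExt y 0 = y 0 := pathExt_of_mem y (by simp)
  -- For ε = 0 the quotient s / ε is 0: the curve is constant and the time interval is one point.
  refine ⟨fun s => (pathExt y (s / ε), p), by simp [hy0], ?_, ?_⟩
  · intro s hs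
    rcases eq_or_ne ε 0 with rfl | hε
    · have hs0 : Set.uIcc (0 : ℝ) 0 = {s} := by
        rw [Set.uIcc_self] at hs ⊢
        rw [Set.mem_singleton_iff.1 hs]
      rw [hs0]
      exact HasFDerivWithinAt.of_subsingleton Set.subsingleton_singleton
    · have hmaps : Set.MapsTo (fun s : ℝ => s / ε) (Set.uIcc 0 ε) (Set.Icc 0 1) := by
        intro s hs
        rcases lt_or_gt_of_ne hε with hneg | hpos
        · rw [Set.uIcc_of_ge hneg.le] at hs
          exact ⟨div_nonneg_of_nonpos hs.2 hneg.le, (div_le_one_of_neg hneg).2 hs.1⟩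
        · rw [Set.uIcc_of_le hpos.le] at hs
          exact ⟨div_nonneg hs.1 hpos.le, (div_le_one hpos).2 hs.2⟩
      have h1 := hasDerivWithinAt_of_pathDefect_eq_zero h (hmaps hs)
      have h2 : HasDerivWithinAt (fun s : ℝ => s / ε) (1 / ε) (Set.uIcc 0 ε) s :=
        (hasDerivWithinAt_id s _).div_const ε
      have h3 := h1.scomp s h2 hmaps
      rw [velocity_smul, smul_smul, one_div_mul_cancel hε, one_smul] at h3
      exact h3.prodMk (hasDerivWithinAt_const s _ p)
  · split_ifs with hε
    · rw [h0 hε, constPath_apply]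
    · have h1 := mean_of_pathDefect_eq_zero h
      rw [mean_apply] at h1
      simp only
      rw [intervalIntegral.integral_comp_div _ hε, smul_smul, inv_mul_cancel₀ hε, one_smul,
        zero_div, div_self hε, h1]

theorem exists_path_of_isXAverage {ε : ℝ} {y p x : Coord d} (h : IsXAverage π ε y p x) :
    ∃ u : C(I, Coord d), u 0 = y ∧ pathDefect (velocity hπ) (u, x, ε • p) = 0 := by
  obtain ⟨γ, hγ0, hγ, hx⟩ := h
  rcases eq_or_ne ε 0 with rfl | hε
  · rw [if_pos rfl] at hx
    exact ⟨constPath x, by rw [constPath_apply, hx], by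
      rw [zero_smul]; exact pathDefect_constPath (velocity_zero hπ) x⟩
  rw [if_neg hε] at hx
  have hmaps : Set.MapsTo (fun t : ℝ => t * ε) (Set.Icc 0 1) (Set.uIcc 0 ε) := by
    intro t ht
    rcases lt_or_gt_of_ne hε with hneg | hpos
    · rw [Set.uIcc_of_ge hneg.le]
      exact ⟨by nlinarith [ht.1, ht.2], mul_nonpos_of_nonneg_of_nonpos ht.1 hneg.le⟩
    · rw [Set.uIcc_of_le hpos.le]
      exact ⟨mul_nonneg ht.1 hpos.le, by nlinarith [ht.1, ht.2]⟩
  have hd : ∀ t ∈ Set.Icc (0 : ℝ) 1, HasDerivWithinAt (fun t => γ (t * ε))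
      (ε • spray π (γ (t * ε))) (Set.Icc 0 1) t := fun t ht => by
    have h2 : HasDerivWithinAt (fun t : ℝ => t * ε) ε (Set.Icc 0 1) t := by
      simpa using (hasDerivWithinAt_id t (Set.Icc (0 : ℝ) 1)).mul_const ε
    exact (hγ (t * ε) (hmaps ht)).scomp t h2 hmaps
  -- The spray is flat, so the momentum stays equal to p along the curve.
  have hd2 : ∀ t ∈ Set.Icc (0 : ℝ) 1, HasDerivWithinAt (fun t => (γ (t * ε)).2) 0
      (Set.Icc 0 1) t := fun t ht => by
    have := (ContinuousLinearMap.snd ℝ (Coord d) (Coord d)).hasFDerivAt.comp_hasDerivWithinAt t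
      (hd t ht)
    simpa [spray] using! this
  have hp : ∀ t ∈ Set.Icc (0 : ℝ) 1, (γ (t * ε)).2 = p := by
    intro t ht
    have := constant_of_derivWithin_zero (fun t ht => (hd2 t ht).differentiableWithinAt)
      (fun t ht => (hd2 t ⟨ht.1, ht.2.le⟩).derivWithin
        (uniqueDiffOn_Icc zero_lt_one t ⟨ht.1, ht.2.le⟩)) t ht
    rw [this, zero_mul, hγ0]
  have hc : ContinuousOn (fun t => (γ (t * ε)).1) (Set.Icc 0 1) := fun t ht =>
    ((hd t ht).continuousWithinAt).fst
  let u : C(I, Coord d) := ⟨fun t => (γ (t * ε)).1, hc.domRestrict⟩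
  have hu : ∀ t ∈ Set.Icc (0 : ℝ) 1, pathExt u t = (γ (t * ε)).1 := fun t ht =>
    pathExt_of_mem u ht
  refine ⟨u, by
    change (γ (0 * ε)).1 = y
    rw [zero_mul, hγ0], pathDefect_eq_zero (fun t ht => ?_) ?_⟩
  · have h1 := (ContinuousLinearMap.fst ℝ (Coord d) (Coord d)).hasFDerivAt.comp_hasDerivWithinAt t
      (hd t ht)
    have h2 : velocity hπ (pathExt u t, ε • p) = (ε • spray π (γ (t * ε))).1 := by
      rw [velocity_smul, hu t ht, ← hp t ht]
      rfl
    rw [h2]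
    exact h1.congr hu (hu t ht)
  · rw [mean_apply, hx]
    have h4 : ∫ s in (0 : ℝ)..1, pathExt u s = ∫ s in (0 : ℝ)..1, (γ (s * ε)).1 := by
      refine intervalIntegral.integral_congr fun s hs => ?_
      rw [Set.uIcc_of_le zero_le_one] at hs
      exact hu s hs
    rw [h4, intervalIntegral.integral_comp_mul_right (fun s => (γ s).1) hε, zero_mul, one_mul]

theorem eq_of_pathDefect_zero_momentum {u : C(I, Coord d)} {x : Coord d}
    (h : pathDefect (velocity hπ) (u, x, 0) = 0) : u = constPath x := by
  have h1 : (velocity hπ).comp (pairPath (u, 0)) = 0 := by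
    ext t : 1
    rw [ContinuousMap.comp_apply, pairPath_apply, velocity_zero]
    rfl
  rw [pathDefect, h1, map_zero, sub_zero, sub_eq_zero] at h
  exact h

/-- Existence of the Karasev map. -/
theorem exists_isKarasevMap (hπ : ∀ i j, ContDiff ℝ ∞ (fun x => π x i j)) : ∃ U α, IsKarasevMap π U α := by
  choose r hr ρ hρ hρr Y hY hsol huniq using
    exists_local_path (w := velocity hπ) (contDiff_spray hπ) (velocity_zero hπ)
  classical
  -- Some ball containing v is chosen arbitrarily; `hglue` makes the value independent of the
  -- choice.
  let A : Coord d × Coord d → C(I, Coord d) := fun v =>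
    if h : ∃ x₀, v ∈ Metric.ball (x₀, (0 : Coord d)) (ρ x₀) then Y h.choose v else 0
  have hglue : ∀ x₀ x₁ v, v ∈ Metric.ball (x₀, (0 : Coord d)) (ρ x₀) →
      v ∈ Metric.ball (x₁, (0 : Coord d)) (ρ x₁) → r x₁ ≤ r x₀ → Y x₀ v = Y x₁ v := by
    intro x₀ x₁ v h0 h1 hle
    have hd : ∀ {x}, v ∈ Metric.ball (x, (0 : Coord d)) (ρ x) → ‖v.1 - x‖ < r x / 4 := by
      intro x hx
      rw [Metric.mem_ball, dist_eq_norm] at hx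
      exact ((norm_fst_le _).trans_lt hx).trans_le (hρr x)
    have hr0 := hr x₀
    refine huniq x₀ v (Metric.ball_subset_ball ((hρr x₀).trans (by linarith)) h0) _ _
      ((hsol x₀ v h0).1.trans (by linarith)) ?_ (hsol x₀ v h0).2 (hsol x₁ v h1).2
    -- Through v.1, the centres are less than r x₀ / 4 + r x₁ / 4 apart, and Y x₁ v is within r x₁ /
    -- 4 of x₁. As r x₁ ≤ r x₀, the total is below r x₀, so uniqueness around x₀ applies.
    have e : Y x₁ v - constPath x₀ =
        (Y x₁ v - constPath x₁) + constPath ((v.1 - x₀) - (v.1 - x₁)) := by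
      rw [show (v.1 - x₀) - (v.1 - x₁) = x₁ - x₀ by abel, map_sub]
      abel
    rw [e]
    have n1 := norm_add_le (Y x₁ v - constPath x₁) (constPath ((v.1 - x₀) - (v.1 - x₁)))
    have n2 := norm_sub_le (v.1 - x₀) (v.1 - x₁)
    rw [norm_constPath] at n1
    linarith [(hsol x₁ v h1).1, hd h0, hd h1]
  have hA : ∀ x₀ v, v ∈ Metric.ball (x₀, (0 : Coord d)) (ρ x₀) → A v = Y x₀ v := by
    intro x₀ v hv
    have hex : ∃ x₀, v ∈ Metric.ball (x₀, (0 : Coord d)) (ρ x₀) := ⟨x₀, hv⟩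
    have e : A v = Y hex.choose v := dif_pos hex
    rw [e]
    rcases le_total (r x₀) (r hex.choose) with hle | hle
    · exact hglue _ _ v hex.choose_spec hv hle
    · exact (hglue _ _ v hv hex.choose_spec hle).symm
  have hA0 : ∀ x, A (x, 0) = constPath x := by
    intro x
    have hx : (x, (0 : Coord d)) ∈ Metric.ball (x, (0 : Coord d)) (ρ x) :=
      Metric.mem_ball_self (hρ x)
    rw [hA x _ hx]
    exact eq_of_pathDefect_zero_momentum hπ (hsol x _ hx).2
  let sc : ℝ × Coord d × Coord d → Coord d × Coord d := fun w => (w.2.1, w.1 • w.2.2)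
  have hsc : ContDiff ℝ ∞ sc := by fun_prop
  refine ⟨sc ⁻¹' ⋃ x₀, Metric.ball (x₀, (0 : Coord d)) (ρ x₀),
    fun ε x p => A (x, ε • p) 0, ⟨?_, ?_, ?_, ?_, ?_⟩⟩
  · exact (isOpen_iUnion fun _ => Metric.isOpen_ball).preimage hsc.continuous
  · intro x p
    exact Set.mem_iUnion.2 ⟨x, by simpa [sc] using hρ x⟩
  · intro ε x
    exact Set.mem_iUnion.2 ⟨x, by simpa [sc] using hρ x⟩
  · intro z hz
    obtain ⟨x₀, hx₀⟩ := Set.mem_iUnion.1 hz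
    have hmem : ∀ᶠ z' in 𝓝 z, sc z' ∈ Metric.ball (x₀, (0 : Coord d)) (ρ x₀) :=
      hsc.continuous.continuousAt.eventually (Metric.isOpen_ball.eventually_mem hx₀)
    have h1 : ContDiffAt ℝ ∞ (fun z => Y x₀ (sc z)) z :=
      ((hY x₀).contDiffAt (Metric.isOpen_ball.mem_nhds hx₀)).comp z hsc.contDiffAt
    have hL : ContDiff ℝ ∞ (fun f : C(I, Coord d) => ContinuousMap.evalCLM ℝ (0 : I) f) :=
      ContinuousLinearMap.contDiff _
    have h2 : ContDiffAt ℝ ∞ (fun z => (ContinuousMap.evalCLM ℝ (0 : I)) (Y x₀ (sc z))) z :=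
      hL.contDiffAt.comp z h1
    refine (h2.congr_of_eventuallyEq ?_).contDiffWithinAt
    filter_upwards [hmem] with z' hz'
    exact congrArg (fun f : C(I, Coord d) => f 0) (hA x₀ _ hz')
  · intro ε x p hz
    obtain ⟨x₀, hx₀⟩ := Set.mem_iUnion.1 hz
    have h1 := (hsol x₀ _ hx₀).2
    rw [← hA x₀ _ hx₀] at h1
    refine isXAverage_of_pathDefect hπ h1 fun hε => ?_
    rw [hε, zero_smul]
    exact hA0 x

/-- A Karasev map agrees near the zero section with the endpoints of the paths solving the integral
equation. -/
theorem IsKarasevMap.exists_path {U : Set (ℝ × Coord d × Coord d)}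
    {α : ℝ → Coord d → Coord d → Coord d} (hα : IsKarasevMap π U α) (ε : ℝ) (x₀ : Coord d) :
    ∃ Y : Coord d × Coord d → C(I, Coord d), ∃ ρ > 0,
      ContDiffOn ℝ ∞ Y (Metric.ball (x₀, 0) ρ) ∧
      (∀ v ∈ Metric.ball (x₀, 0) ρ, pathDefect (velocity hπ) (Y v, v) = 0) ∧
      ∀ᶠ z : Coord d × Coord d in 𝓝 (x₀, 0),
        α ε z.1 z.2 = Y (z.1, ε • z.2) 0 ∧ α ε z.1 (-z.2) = Y (z.1, ε • z.2) 1 := by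
  obtain ⟨r, hr, ρ, hρ, hρr, Y, hY, hsol, huniq⟩ :=
    exists_local_path (w := velocity hπ) (contDiff_spray hπ) (velocity_zero hπ) x₀
  refine ⟨Y, ρ, hρ, hY, fun v hv => (hsol v hv).2, ?_⟩
  have hα0 : α ε x₀ 0 = x₀ := by
    obtain ⟨u, hu0, hu⟩ := exists_path_of_isXAverage hπ
      (hα.relation ε x₀ 0 (hα.section_mem ε x₀))
    rw [smul_zero] at hu
    rw [← hu0, eq_of_pathDefect_zero_momentum hπ hu, constPath_apply]
  -- A path of the given map α starts near x₀ by continuity and is slow for small momentum, so it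
  -- stays in the ball where the solution is unique.
  have hvel : ∀ᶠ q in 𝓝 (0 : Coord d), ∀ v ∈ Metric.closedBall x₀ r,
      ‖velocity hπ (v, q)‖ < r / 2 := by
    refine (isCompact_closedBall x₀ r).eventually_forall_of_forall_eventually fun v _ => ?_
    have hc : Continuous fun z : Coord d × Coord d => ‖velocity hπ (z.2, z.1)‖ := by fun_prop
    refine hc.continuousAt.eventually_lt continuousAt_const ?_
    simpa [velocity_zero] using hr
  -- conditions at `(x, p)` which put the path through `α_ε(x, p)` in the uniqueness range
  have hgood : ∀ᶠ z : Coord d × Coord d in 𝓝 (x₀, 0), ∃ u : C(I, Coord d), u 0 = α ε z.1 z.2 ∧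
      pathDefect (velocity hπ) (u, z.1, ε • z.2) = 0 ∧ ‖u - constPath x₀‖ < r := by
    have hin : Continuous fun z : Coord d × Coord d => (ε, z.1, z.2) := by fun_prop
    have hU : ∀ᶠ z : Coord d × Coord d in 𝓝 (x₀, 0), (ε, z.1, z.2) ∈ U :=
      hin.continuousAt.eventually (hα.isOpen.eventually_mem (hα.section_mem ε x₀))
    have hcont : ContinuousAt (fun z : Coord d × Coord d => α ε z.1 z.2) (x₀, 0) := by
      have h1 := (hα.smooth.contDiffAt
        (hα.isOpen.mem_nhds (hα.section_mem ε x₀))).continuousAt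
      exact ContinuousAt.comp (f := fun z : Coord d × Coord d => (ε, z.1, z.2))
        (x := (x₀, (0 : Coord d))) h1 hin.continuousAt
    have hnear : ∀ᶠ z : Coord d × Coord d in 𝓝 (x₀, 0), ‖α ε z.1 z.2 - x₀‖ < r / 4 := by
      refine (hcont.sub_const x₀).norm.eventually_lt continuousAt_const ?_
      simpa [hα0] using hr
    have hsmul : Tendsto (fun z : Coord d × Coord d => ε • z.2) (𝓝 (x₀, 0)) (𝓝 0) := by
      have : Continuous fun z : Coord d × Coord d => ε • z.2 := by fun_prop
      simpa using this.tendsto (x₀, 0)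
    filter_upwards [hU, hnear, hsmul.eventually hvel] with z hzU hz hzv
    obtain ⟨u, hu0, hu⟩ := exists_path_of_isXAverage hπ (hα.relation ε z.1 z.2 hzU)
    refine ⟨u, hu0, hu, norm_sub_constPath_lt hr hu (by rw [hu0]; exact hz.le) fun v hv => ?_⟩
    exact hzv v (by rwa [mem_closedBall_iff_norm])
  have hneg : Tendsto (fun z : Coord d × Coord d => (z.1, -z.2)) (𝓝 (x₀, 0)) (𝓝 (x₀, 0)) := by
    have : Continuous fun z : Coord d × Coord d => (z.1, -z.2) := by fun_prop
    simpa using this.tendsto (x₀, 0)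
  have hball : ∀ᶠ z : Coord d × Coord d in 𝓝 (x₀, 0),
      (z.1, ε • z.2) ∈ Metric.ball (x₀, (0 : Coord d)) ρ := by
    have : Continuous fun z : Coord d × Coord d => (z.1, ε • z.2) := by fun_prop
    exact this.continuousAt.eventually (Metric.isOpen_ball.eventually_mem (by simpa using hρ))
  filter_upwards [hgood, hneg.eventually hgood, hball] with z h1 h2 hz
  have hz' := Metric.ball_subset_ball (hρr.trans (by linarith : r / 4 ≤ r)) hz
  have hYr : ‖Y (z.1, ε • z.2) - constPath x₀‖ < r :=
    (hsol _ hz).1.trans (by linarith : r / 4 < r)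
  obtain ⟨u, hu0, hu, hur⟩ := h1
  obtain ⟨v, hv0, hv, hvr⟩ := h2
  constructor
  · rw [← hu0, huniq _ hz' u _ hur hYr hu (hsol _ hz).2]
  -- The path for -q starts at α_ε(x, -p); its reversal is the path for q, so this starting point is
  -- the value of Y at time 1.
  · have hv' := pathDefect_revPath (velocity_neg hπ) hv
    rw [smul_neg, neg_neg] at hv'
    have hrev : ‖revPath v - constPath x₀‖ < r := by
      refine lt_of_le_of_lt ((ContinuousMap.norm_le _ (norm_nonneg _)).2 fun t => ?_) hvr
      exact (v - constPath x₀).norm_coe_le_norm (σ t)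
    rw [← hv0, ← huniq _ hz' _ _ hrev hYr hv' (hsol _ hz).2, revPath_apply]
    simp

end Karasev

/-! ### Linear matrix equations and the endpoint identity -/

section MatrixODE

open Matrix

variable {d : ℕ}

/-- Entrywise derivative at `t` within `[0, 1]` of a matrix valued function. -/
def HasMatrixDeriv (M : ℝ → Matrix (Fin d) (Fin d) ℝ) (M' : Matrix (Fin d) (Fin d) ℝ) (t : ℝ) :
    Prop :=
  ∀ i j, HasDerivWithinAt (fun s => M s i j) (M' i j) (Set.Icc 0 1) t

namespace HasMatrixDeriv

variable {M N : ℝ → Matrix (Fin d) (Fin d) ℝ} {M' N' : Matrix (Fin d) (Fin d) ℝ} {t : ℝ}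

theorem congr_deriv (hM : HasMatrixDeriv M M' t) (h : M' = N') : HasMatrixDeriv M N' t := h ▸ hM

protected theorem const (C : Matrix (Fin d) (Fin d) ℝ) (t : ℝ) : HasMatrixDeriv (fun _ => C) 0 t :=
  fun _ _ => hasDerivWithinAt_const _ _ _

protected theorem add (hM : HasMatrixDeriv M M' t) (hN : HasMatrixDeriv N N' t) :
    HasMatrixDeriv (fun s => M s + N s) (M' + N') t := fun i j => (hM i j).add (hN i j)

protected theorem sub (hM : HasMatrixDeriv M M' t) (hN : HasMatrixDeriv N N' t) :
    HasMatrixDeriv (fun s => M s - N s) (M' - N') t := fun i j => (hM i j).sub (hN i j)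

protected theorem transpose (hM : HasMatrixDeriv M M' t) :
    HasMatrixDeriv (fun s => (M s)ᵀ) M'ᵀ t := fun i j => hM j i

protected theorem mul (hM : HasMatrixDeriv M M' t) (hN : HasMatrixDeriv N N' t) :
    HasMatrixDeriv (fun s => M s * N s) (M' * N t + M t * N') t := fun i j => by
  have h := HasDerivWithinAt.fun_sum (u := Finset.univ) fun k _ => (hM i k).mul (hN k j)
  simpa only [Matrix.add_apply, Matrix.mul_apply, ← Finset.sum_add_distrib] using! h

protected theorem const_mul (hM : HasMatrixDeriv M M' t) (C : Matrix (Fin d) (Fin d) ℝ) :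
    HasMatrixDeriv (fun s => C * M s) (C * M') t :=
  ((HasMatrixDeriv.const C t).mul hM).congr_deriv (by simp)

protected theorem mul_const (hM : HasMatrixDeriv M M' t) (C : Matrix (Fin d) (Fin d) ℝ) :
    HasMatrixDeriv (fun s => M s * C) (M' * C) t :=
  (hM.mul (HasMatrixDeriv.const C t)).congr_deriv (by simp)

end HasMatrixDeriv

theorem abs_sum_mul_le {f g : Fin d → ℝ} {b c : ℝ} (hf : ∀ l, |f l| ≤ b) (hg : ∀ l, |g l| ≤ c) :
    |∑ l, f l * g l| ≤ d * b * c := by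
  calc |∑ l, f l * g l| ≤ ∑ l, |f l * g l| := Finset.abs_sum_le_sum_abs _ _
    _ ≤ ∑ _l : Fin d, b * c := Finset.sum_le_sum fun l _ => by
        rw [abs_mul]
        exact mul_le_mul (hf l) (hg l) (abs_nonneg _) ((abs_nonneg _).trans (hf l))
    _ = d * b * c := by simp [mul_assoc]

/-- Uniqueness for the linear matrix equation `e' = A e + e B`. -/
theorem matrixODE_eq_zero {A B e : ℝ → Matrix (Fin d) (Fin d) ℝ} {c : ℝ}
    (hA : ∀ t ∈ Set.Icc (0 : ℝ) 1, ∀ i j, |A t i j| ≤ c)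
    (hB : ∀ t ∈ Set.Icc (0 : ℝ) 1, ∀ i j, |B t i j| ≤ c)
    (he : ∀ t ∈ Set.Icc (0 : ℝ) 1, HasMatrixDeriv e (A t * e t + e t * B t) t)
    (h0 : e 0 = 0) : ∀ t ∈ Set.Icc (0 : ℝ) 1, e t = 0 := by
  let f : ℝ → Fin d → Fin d → ℝ := fun t i j => e t i j
  let f' : ℝ → Fin d → Fin d → ℝ := fun t i j => (A t * e t + e t * B t) i j
  have hf : ∀ t ∈ Set.Icc (0 : ℝ) 1, HasDerivWithinAt f (f' t) (Set.Icc 0 1) t := fun t ht =>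
    hasDerivWithinAt_pi.2 fun i => hasDerivWithinAt_pi.2 fun j => he t ht i j
  have hle : ∀ t i j, |e t i j| ≤ ‖f t‖ := fun t i j =>
    (norm_le_pi_norm (f t i) j).trans (norm_le_pi_norm (f t) i)
  have key := eq_zero_of_abs_deriv_le_mul_abs_self_of_eq_zero_right (f := f) (f' := f')
    (K := |(2 * d * c)|) (a := 0) (b := 1) (fun t ht => (hf t ht).continuousWithinAt)
    (fun t ht => (hf t ⟨ht.1, ht.2.le⟩).mono_of_mem_nhdsWithin (Icc_mem_nhdsGE_of_mem ht))
    (funext fun i => funext fun j => by simp [f, h0]) (fun t ht => by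
      have ht' : t ∈ Set.Icc (0 : ℝ) 1 := ⟨ht.1, ht.2.le⟩
      refine (pi_norm_le_iff_of_nonneg (by positivity)).2 fun i =>
        (pi_norm_le_iff_of_nonneg (by positivity)).2 fun j => ?_
      have h1 := abs_sum_mul_le (fun l => hA t ht' i l) (fun l => hle t l j)
      have h2 := abs_sum_mul_le (fun l => hle t i l) (fun l => hB t ht' l j)
      have h3 : f' t i j = ∑ l, A t i l * e t l j + ∑ l, e t i l * B t l j := rfl
      rw [Real.norm_eq_abs, h3]
      refine (abs_add_le _ _).trans ((add_le_add h1 h2).trans ?_)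
      calc d * c * ‖f t‖ + d * ‖f t‖ * c = 2 * d * c * ‖f t‖ := by ring
        _ ≤ |2 * d * c| * ‖f t‖ := by gcongr; exact le_abs_self _)
  intro t ht
  ext i j
  exact congrFun (congrFun (key t ht) i) j

/-- The linear algebra behind the commutation of source and target: `W` and `Z` are the derivatives
of a path of mean `x` in the directions `x` and `q`. -/
theorem endpoint_identity {A W Z P : ℝ → Matrix (Fin d) (Fin d) ℝ} {c : ℝ}
    (hA : ∀ t ∈ Set.Icc (0 : ℝ) 1, ∀ i j, |A t i j| ≤ c)
    (hW : ∀ t ∈ Set.Icc (0 : ℝ) 1, HasMatrixDeriv W (A t * W t) t)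
    (hZ : ∀ t ∈ Set.Icc (0 : ℝ) 1, HasMatrixDeriv Z (A t * Z t + P t) t)
    (hP : ∀ t ∈ Set.Icc (0 : ℝ) 1, HasMatrixDeriv P (A t * P t + P t * (A t)ᵀ) t)
    (hskew : (P 0)ᵀ = -P 0) (hdet : IsUnit (W 0).det)
    (hWc : ∀ i j, Continuous fun t => W t i j) (hZc : ∀ i j, Continuous fun t => Z t i j)
    (hWint : ∀ i j, ∫ t in (0 : ℝ)..1, W t i j = (1 : Matrix (Fin d) (Fin d) ℝ) i j)
    (hZint : ∀ i j, ∫ t in (0 : ℝ)..1, Z t i j = 0) :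
    W 0 * (Z 1)ᵀ = Z 0 * (W 1)ᵀ := by
  have hA0 : ∀ t ∈ Set.Icc (0 : ℝ) 1, ∀ i j, |(A t)ᵀ i j| ≤ c := fun t ht i j => hA t ht j i
  have m1 : (1 : ℝ) ∈ Set.Icc (0 : ℝ) 1 := by simp
  set V := (W 0)⁻¹ with hV
  have hWV : W 0 * V = 1 := mul_nonsing_inv _ hdet
  have hVWt : Vᵀ * (W 0)ᵀ = 1 := by rw [← transpose_mul, hWV, transpose_one]
  set C := V * P 0 * Vᵀ with hC
  have hCt : Cᵀ = -C := by
    simp only [hC, transpose_mul, transpose_transpose, hskew]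
    simp [Matrix.mul_assoc]
  -- Both sides solve the same linear equation and agree at 0 by the choice of C, which inherits
  -- skewness from P 0.
  have hPW : ∀ t ∈ Set.Icc (0 : ℝ) 1, P t = W t * C * (W t)ᵀ := by
    intro t ht
    refine sub_eq_zero.1 (matrixODE_eq_zero (A := A) (B := fun t => (A t)ᵀ)
      (e := fun t => P t - W t * C * (W t)ᵀ) hA hA0 (fun s hs => ?_) ?_ t ht)
    · refine ((hP s hs).sub (((hW s hs).mul_const C).mul (hW s hs).transpose)).congr_deriv ?_
      rw [transpose_mul]
      noncomm_ring
    · have : W 0 * C * (W 0)ᵀ = (W 0 * V) * P 0 * (Vᵀ * (W 0)ᵀ) := by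
        rw [hC]; noncomm_ring
      rw [this, hWV, hVWt]
      simp
  let F : ℝ → Matrix (Fin d) (Fin d) ℝ := fun t => Matrix.of fun i j => ∫ s in (0 : ℝ)..t, W s i j
  let L : ℝ → Matrix (Fin d) (Fin d) ℝ := fun t => Matrix.of fun i j => ∫ s in (0 : ℝ)..t, Z s i j
  have hF : ∀ t, HasMatrixDeriv F (W t) t := fun t i j =>
    ((hWc i j).integral_hasStrictDerivAt 0 t).hasDerivAt.hasDerivWithinAt
  have hL : ∀ t, HasMatrixDeriv L (Z t) t := fun t i j =>
    ((hZc i j).integral_hasStrictDerivAt 0 t).hasDerivAt.hasDerivWithinAt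
  have hF0 : F 0 = 0 := by ext i j; simp [F]
  have hL0 : L 0 = 0 := by ext i j; simp [L]
  have hF1 : F 1 = 1 := by ext i j; exact hWint i j
  have hL1 : L 1 = 0 := by ext i j; exact hZint i j
  set G := V * Z 0 with hG
  -- Variation of constants: given P = W C Wᵀ, a particular solution is W C Fᵀ, with F the primitive
  -- of W.
  have hZW : ∀ t ∈ Set.Icc (0 : ℝ) 1, Z t = W t * (G + C * (F t)ᵀ) := by
    intro t ht
    refine sub_eq_zero.1 (matrixODE_eq_zero (A := A) (B := fun _ => 0)
      (e := fun t => Z t - W t * (G + C * (F t)ᵀ)) (c := |c|)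
      (fun s hs i j => (hA s hs i j).trans (le_abs_self c)) (fun s _ i j => by simp)
      (fun s hs => ?_) ?_ t ht)
    · refine ((hZ s hs).sub ((hW s hs).mul ((HasMatrixDeriv.const G s).add
        ((hF s).transpose.const_mul C)))).congr_deriv ?_
      rw [hPW s hs]
      noncomm_ring
    · rw [hF0, transpose_zero, Matrix.mul_zero, add_zero, hG, ← Matrix.mul_assoc, hWV,
        Matrix.one_mul, sub_self]
  -- By the formula for Z and the skewness of C this expression has zero derivative. Since ∫ W = 1
  -- and ∫ Z = 0, its value at 1 is C + G - Gᵀ.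
  have hΘ := matrixODE_eq_zero (A := fun _ => 0) (B := fun _ => 0) (c := 0)
    (e := fun t => F t * C * (F t)ᵀ - L t + F t * G + (L t)ᵀ - Gᵀ * (F t)ᵀ)
    (fun s _ i j => by simp) (fun s _ i j => by simp)
    (fun s hs => by
      refine ((((((hF s).mul_const C).mul (hF s).transpose).sub (hL s)).add
        ((hF s).mul_const G)).add (hL s).transpose |>.sub
          ((hF s).transpose.const_mul Gᵀ)).congr_deriv ?_
      rw [hZW s hs]
      simp only [transpose_mul, transpose_add, transpose_transpose, hCt]
      noncomm_ring)
    (by simp [hF0, hL0]) 1 m1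
  have hGt : G + C = Gᵀ := by
    simp only [hF1, hL1, transpose_one, transpose_zero, Matrix.mul_one, Matrix.one_mul, sub_zero,
      add_zero] at hΘ
    rw [add_comm]
    exact sub_eq_zero.1 hΘ
  have hZ1 : Z 1 = W 1 * Gᵀ := by
    rw [hZW 1 m1, hF1, transpose_one, Matrix.mul_one, hGt]
  have hZ0 : Z 0 = W 0 * G := by
    rw [hG, ← Matrix.mul_assoc, hWV, Matrix.one_mul]
  rw [hZ1, transpose_mul, transpose_transpose, ← Matrix.mul_assoc, ← hZ0]

end MatrixODE

/-! ### Poisson commutation of source and target -/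

section Bracket

open Matrix unitInterval

variable {d : ℕ} {π : Coord d → Matrix (Fin d) (Fin d) ℝ}

/-- The linearization in `y` of the velocity. -/
noncomputable def velocityMatrix (π : Coord d → Matrix (Fin d) (Fin d) ℝ) (y q : Coord d) :
    Matrix (Fin d) (Fin d) ℝ :=
  Matrix.of fun j l => -∑ i, differential (fun y => π y i j) y l * q i

theorem fderiv_apply_eq_sum {f : Coord d → ℝ} (y k : Coord d) :
    fderiv ℝ f y k = ∑ l, differential f y l * k l := by
  conv_lhs => rw [coord_eq_sum_single k]
  rw [map_sum]
  simp only [map_smul, smul_eq_mul, differential]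
  exact Finset.sum_congr rfl fun l _ => mul_comm _ _

/-- Skewness turns -πᵀθ into πθ, so the inhomogeneous term of the linearized equation is the very
matrix that the Jacobi identity transports. -/
theorem fderiv_velocity (hπ : IsPoissonTensor π) (y q k θ : Coord d) (j : Fin d) :
    fderiv ℝ (velocity hπ.smooth) (y, q) (k, θ) j =
      (velocityMatrix π y q *ᵥ k + π y *ᵥ θ) j := by
  have hd : ∀ i, HasFDerivAt (fun z : Coord d × Coord d => π z.1 i j * z.2 i)
      (π y i j • ((ContinuousLinearMap.proj (R := ℝ) (φ := fun _ : Fin d => ℝ) i).comp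
          (ContinuousLinearMap.snd ℝ (Coord d) (Coord d))) +
        q i • ((fderiv ℝ (fun y => π y i j) y).comp
          (ContinuousLinearMap.fst ℝ (Coord d) (Coord d)))) (y, q) := fun i => by
    have h1 : HasFDerivAt (fun z : Coord d × Coord d => π z.1 i j)
        ((fderiv ℝ (fun y => π y i j) y).comp (ContinuousLinearMap.fst ℝ (Coord d) (Coord d)))
        (y, q) :=
      HasFDerivAt.comp (f := fun z : Coord d × Coord d => z.1) (g := fun y => π y i j) (y, q)
        ((hπ.smooth i j).differentiable (by simp) y).hasFDerivAt hasFDerivAt_fst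
    have h2 : HasFDerivAt (fun z : Coord d × Coord d => z.2 i)
        ((ContinuousLinearMap.proj (R := ℝ) (φ := fun _ : Fin d => ℝ) i).comp
          (ContinuousLinearMap.snd ℝ (Coord d) (Coord d))) (y, q) :=
      ((ContinuousLinearMap.proj (R := ℝ) (φ := fun _ : Fin d => ℝ) i).comp
          (ContinuousLinearMap.snd ℝ (Coord d) (Coord d))).hasFDerivAt
    exact h1.mul h2
  have hs := (HasFDerivAt.fun_sum (u := Finset.univ) fun i _ => hd i).fun_neg
  have hv : DifferentiableAt ℝ (velocity hπ.smooth) (y, q) :=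
    (contDiff_spray hπ.smooth).differentiable (by simp) _
  have h3 := (hasFDerivAt_pi'.1 hv.hasFDerivAt j).unique hs
  have h4 := congrArg (fun L : Coord d × Coord d →L[ℝ] ℝ => L (k, θ)) h3
  change fderiv ℝ (velocity hπ.smooth) (y, q) (k, θ) j = _ at h4
  rw [h4]
  simp only [_root_.neg_apply, _root_.sum_apply,
    _root_.add_apply, _root_.smul_apply, ContinuousLinearMap.comp_apply,
    ContinuousLinearMap.coe_fst', ContinuousLinearMap.coe_snd', ContinuousLinearMap.proj_apply,
    smul_eq_mul, Pi.add_apply, Matrix.mulVec, dotProduct, velocityMatrix, Matrix.of_apply,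
    fderiv_apply_eq_sum, neg_mul, Finset.sum_neg_distrib, Finset.sum_mul, Finset.mul_sum,
    Finset.sum_add_distrib, neg_add]
  rw [add_comm, Finset.sum_comm, ← Finset.sum_neg_distrib (f := fun i => π y i j * θ i)]
  congr 1
  · congr 1
    exact Finset.sum_congr rfl fun i _ => Finset.sum_congr rfl fun l _ => by ring
  · exact Finset.sum_congr rfl fun i _ => by rw [hπ.skew y i j]; ring

/-- The Jacobi identity: `π` is transported by the linearized spray. -/
theorem sum_differential_velocity (hπ : IsPoissonTensor π) (y q : Coord d) (i j : Fin d) :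
    ∑ l, differential (fun y => π y i j) y l * velocity hπ.smooth (y, q) l =
      (velocityMatrix π y q * π y + π y * (velocityMatrix π y q)ᵀ) i j := by
  have hds : ∀ a b l, differential (fun y => π y a b) y l = -differential (fun y => π y b a) y l := by
    intro a b l
    have : (fun y => π y a b) = fun y => -π y b a := funext fun y => hπ.skew y b a
    rw [this, differential, differential, fderiv_fun_neg]
    rfl
  -- The Jacobi identity for the indices i, j, m, contracted with q_m.
  have key : ∑ m, q m * ∑ l, (π y i l * differential (fun y => π y j m) y l
        + π y j l * differential (fun y => π y m i) y l
        + π y m l * differential (fun y => π y i j) y l) = 0 :=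
    Finset.sum_eq_zero fun m _ => by rw [hπ.jacobi y i j m, mul_zero]
  rw [← sub_eq_zero, ← neg_eq_zero, ← key]
  simp only [velocity_apply, Matrix.add_apply, Matrix.mul_apply, transpose_apply, velocityMatrix,
    Matrix.of_apply, Finset.mul_sum, Finset.sum_mul, mul_neg, neg_mul]
  rw [← Finset.sum_add_distrib, ← Finset.sum_sub_distrib, ← Finset.sum_neg_distrib, Finset.sum_comm]
  refine Finset.sum_congr rfl fun l _ => ?_
  rw [← Finset.sum_neg_distrib, ← Finset.sum_neg_distrib, ← Finset.sum_neg_distrib,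
    ← Finset.sum_add_distrib, ← Finset.sum_sub_distrib, ← Finset.sum_neg_distrib]
  refine Finset.sum_congr rfl fun m _ => ?_
  rw [hπ.skew y j l, hds m j]
  ring

/-- The derivative of a family of solutions of the integral equation solves the linearized
equation. -/
theorem variation_eq (hπ : IsPoissonTensor π) {Y : Coord d × Coord d → C(I, Coord d)}
    {v : Coord d × Coord d} (hY : DifferentiableAt ℝ Y v)
    (hsol : ∀ᶠ v' in 𝓝 v, pathDefect (velocity hπ.smooth) (Y v', v') = 0) (ξ θ : Coord d) :
    mean (fderiv ℝ Y v (ξ, θ)) = ξ ∧ ∀ t ∈ Set.Icc (0 : ℝ) 1, ∀ j,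
      HasDerivWithinAt (fun t => pathExt (fderiv ℝ Y v (ξ, θ)) t j)
        ((velocityMatrix π (pathExt (Y v) t) v.2 *ᵥ pathExt (fderiv ℝ Y v (ξ, θ)) t
          + π (pathExt (Y v) t) *ᵥ θ) j) (Set.Icc 0 1) t := by
  have hw := contDiff_spray hπ.smooth
  let w' : C(Coord d × Coord d, Coord d × Coord d →L[ℝ] Coord d) :=
    ⟨fderiv ℝ (velocity hπ.smooth), hw.continuous_fderiv (by simp)⟩
  have hw' : ∀ x, HasFDerivAt (velocity hπ.smooth) (w' x) x := fun x =>
    (hw.differentiable (by simp) x).hasFDerivAt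
  have h1 : HasFDerivAt (fun v => (Y v, v))
      ((fderiv ℝ Y v).prod (ContinuousLinearMap.id ℝ _)) v :=
    hY.hasFDerivAt.prodMk (hasFDerivAt_id v)
  have h2 : HasFDerivAt (fun v => pathDefect (velocity hπ.smooth) (Y v, v)) _ v :=
    HasFDerivAt.comp (f := fun v => (Y v, v)) v (hasFDerivAt_pathDefect hw' (Y v, v)) h1
  have h3 := h2.unique ((hasFDerivAt_const (0 : C(I, Coord d)) v).congr_of_eventuallyEq hsol)
  set u := fderiv ℝ Y v (ξ, θ) with hu
  set g := pointwiseApply (w'.comp (pairPath (Y v, v.2))) (pairPath (u, θ)) with hg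
  -- The identity pathDefect (Y v', v') = 0, differentiated along (ξ, θ), is an integral equation of
  -- the same form for u, with velocity g.
  have h4 : u - constPath ξ - (primitive g - constPath (mean (primitive g))) = 0 :=
    congrArg (fun L : Coord d × Coord d →L[ℝ] C(I, Coord d) => L (ξ, θ)) h3
  have h5 : u = constPath (ξ - mean (primitive g)) + primitive g := by
    rw [map_sub]
    exact (sub_eq_zero.1 ((sub_sub _ _ _).symm.trans h4)).trans (by abel)
  constructor
  · rw [h5, map_add, mean_constPath, sub_add_cancel]
  · intro t ht j
    have h6 := hasDerivWithinAt_pi.1 (hasDerivWithinAt_pathExt h5 ht) j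
    have h7 : pathExt g t j = (velocityMatrix π (pathExt (Y v) t) v.2 *ᵥ pathExt u t
        + π (pathExt (Y v) t) *ᵥ θ) j := by
      rw [pathExt_of_mem g ht, hg, pointwiseApply_apply, ContinuousMap.comp_apply, pairPath_apply,
        pairPath_apply, pathExt_of_mem u ht, pathExt_of_mem (Y v) ht]
      exact fderiv_velocity hπ _ _ _ _ j
    rwa [h7] at h6

theorem exists_velocityMatrix_bound (hπ : IsPoissonTensor π) (y : C(I, Coord d)) (q : Coord d) :
    ∃ c, ∀ t ∈ Set.Icc (0 : ℝ) 1, ∀ i j, |velocityMatrix π (pathExt y t) q i j| ≤ c := by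
  have hc : Continuous fun t : ℝ => fun i j => velocityMatrix π (pathExt y t) q i j := by
    refine continuous_pi fun i => continuous_pi fun j => ?_
    simp only [velocityMatrix, Matrix.of_apply, differential]
    refine (continuous_finsetSum _ fun k _ => Continuous.mul ?_ continuous_const).neg
    exact ((((hπ.smooth k i).continuous_fderiv (by simp)).comp
      (continuous_pathExt y)).clm_apply continuous_const)
  obtain ⟨c, hc⟩ := isCompact_Icc.exists_bound_of_continuousOn (s := Set.Icc (0 : ℝ) 1)
    hc.continuousOn
  exact ⟨c, fun t ht i j =>
    ((norm_le_pi_norm (fun j => velocityMatrix π (pathExt y t) q i j) j).trans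
      (norm_le_pi_norm (fun i j => velocityMatrix π (pathExt y t) q i j) i)).trans (hc t ht)⟩

/-- The source and target maps commute for the canonical bracket. -/
theorem endpoint_bracket (hπ : IsPoissonTensor π) {Y : Coord d × Coord d → C(I, Coord d)}
    {v : Coord d × Coord d} (hY : DifferentiableAt ℝ Y v)
    (hsol : ∀ᶠ v' in 𝓝 v, pathDefect (velocity hπ.smooth) (Y v', v') = 0)
    (hdet : (Matrix.of fun j k => fderiv ℝ Y v (Pi.single k 1, 0) 0 j).det ≠ 0) :
    (Matrix.of fun j k => fderiv ℝ Y v (Pi.single k 1, 0) 0 j) *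
        (Matrix.of fun j k => fderiv ℝ Y v (0, Pi.single k 1) 1 j)ᵀ =
      (Matrix.of fun j k => fderiv ℝ Y v (0, Pi.single k 1) 0 j) *
        (Matrix.of fun j k => fderiv ℝ Y v (Pi.single k 1, 0) 1 j)ᵀ := by
  let W : ℝ → Matrix (Fin d) (Fin d) ℝ := fun t =>
    Matrix.of fun j k => pathExt (fderiv ℝ Y v (Pi.single k 1, 0)) t j
  let Z : ℝ → Matrix (Fin d) (Fin d) ℝ := fun t =>
    Matrix.of fun j k => pathExt (fderiv ℝ Y v (0, Pi.single k 1)) t j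
  obtain ⟨c, hc⟩ := exists_velocityMatrix_bound hπ (Y v) v.2
  have hpe0 : ∀ u : C(I, Coord d), pathExt u 0 = u 0 := fun u => pathExt_of_mem u (by simp)
  have hpe1 : ∀ u : C(I, Coord d), pathExt u 1 = u 1 := fun u => pathExt_of_mem u (by simp)
  have hmean : ∀ (u : C(I, Coord d)) (j : Fin d),
      ∫ t in (0 : ℝ)..1, pathExt u t j = mean u j := fun u j => by
    rw [mean_apply]
    exact (ContinuousLinearMap.proj (R := ℝ) (φ := fun _ : Fin d => ℝ) j).intervalIntegral_comp_comm
      ((continuous_pathExt u).intervalIntegrable _ _)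
  have key := endpoint_identity (A := fun t => velocityMatrix π (pathExt (Y v) t) v.2)
    (W := W) (Z := Z) (P := fun t => π (pathExt (Y v) t)) hc
    (fun t ht j k => by
      have := (variation_eq hπ hY hsol (Pi.single k 1) 0).2 t ht j
      rw [Matrix.mulVec_zero, add_zero] at this
      exact this)
    (fun t ht j k => by
      have := (variation_eq hπ hY hsol 0 (Pi.single k 1)).2 t ht j
      rw [Matrix.mulVec_single_one] at this
      exact this)
    (fun t ht i j => by
      have h1 := hasDerivWithinAt_of_pathDefect_eq_zero
        (x := v.1) (q := v.2) hsol.self_of_nhds ht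
      have h2 := (((hπ.smooth i j).differentiable (by simp)
        (pathExt (Y v) t)).hasFDerivAt).comp_hasDerivWithinAt t h1
      rw [fderiv_apply_eq_sum, sum_differential_velocity hπ] at h2
      exact h2)
    (by ext i j; exact hπ.skew _ i j)
    (by
      rw [isUnit_iff_ne_zero]
      simpa only [W, hpe0] using hdet)
    (fun j k => (continuous_apply j).comp (continuous_pathExt _))
    (fun j k => (continuous_apply j).comp (continuous_pathExt _))
    (fun j k => by
      simp only [W, Matrix.of_apply]
      rw [hmean, (variation_eq hπ hY hsol (Pi.single k 1) 0).1, Pi.single_apply, Matrix.one_apply])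
    (fun j k => by
      simp only [Z, Matrix.of_apply]
      rw [hmean, (variation_eq hπ hY hsol 0 (Pi.single k 1)).1]
      rfl)
  simpa only [W, Z, hpe0, hpe1] using key

/-- `H ∘ α_ε` and `H ∘ β_ε` Poisson commute near the zero section. -/
theorem IsKarasevMap.canonicalBracket_eq_zero (hπ : IsPoissonTensor π)
    {U : Set (ℝ × Coord d × Coord d)} {α : ℝ → Coord d → Coord d → Coord d}
    (hα : IsKarasevMap π U α) {H : Coord d → ℝ} (hH : ContDiff ℝ ∞ H) (ε : ℝ) (x₀ : Coord d) :
    ∀ᶠ z in 𝓝 (x₀, (0 : Coord d)),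
      canonicalBracket (fun z => H (α ε z.1 z.2)) (fun z => H (α ε z.1 (-z.2))) z = 0 := by
  obtain ⟨Y, ρ, hρ, hY, hsol, hαY⟩ := hα.exists_path hπ.smooth ε x₀
  have hb : Metric.ball (x₀, (0 : Coord d)) ρ ∈ 𝓝 (x₀, (0 : Coord d)) := Metric.ball_mem_nhds _ hρ
  have hdiff : ∀ v ∈ Metric.ball (x₀, (0 : Coord d)) ρ, DifferentiableAt ℝ Y v := fun v hv =>
    ((hY.contDiffAt (Metric.isOpen_ball.mem_nhds hv)).differentiableAt (by simp))
  -- As q = εp, every p-derivative carries a factor ε, and the bracket is ε times a contraction of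
  -- the endpoint identity.
  let S : Coord d × Coord d → Coord d × Coord d := fun z => (z.1, ε • z.2)
  have hS : Continuous S := by fun_prop
  have hSt : Tendsto S (𝓝 (x₀, 0)) (𝓝 (x₀, 0)) := by
    simpa [S] using hS.tendsto (x₀, 0)
  -- On the zero section the paths are constant and ∂y(0)/∂x is the identity matrix, so it stays
  -- invertible nearby.
  have hdet : ∀ᶠ v in 𝓝 (x₀, (0 : Coord d)),
      (Matrix.of fun j k => fderiv ℝ Y v (Pi.single k 1, 0) 0 j).det ≠ 0 := by
    have hc : ContinuousAt (fun v =>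
        (Matrix.of fun j k => fderiv ℝ Y v (Pi.single k 1, 0) 0 j).det) (x₀, (0 : Coord d)) := by
      have hf : ContinuousAt (fderiv ℝ Y) (x₀, (0 : Coord d)) :=
        ((hY.contDiffAt hb).fderiv_right (m := ∞) (by simp)).continuousAt
      have hM : ContinuousAt (fun v => (Matrix.of fun j k => fderiv ℝ Y v (Pi.single k 1, 0) 0 j :
          Matrix (Fin d) (Fin d) ℝ)) (x₀, (0 : Coord d)) := by
        refine continuousAt_pi.2 fun j => continuousAt_pi.2 fun k => ?_
        have h1 : ContinuousAt (fun v => fderiv ℝ Y v (Pi.single k 1, 0)) (x₀, (0 : Coord d)) :=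
          hf.clm_apply continuousAt_const
        have h2 : Continuous fun u : C(I, Coord d) => u 0 j :=
          (continuous_apply j).comp (ContinuousEvalConst.continuous_eval_const (0 : I))
        exact h2.continuousAt.comp h1
      exact (Continuous.matrix_det continuous_id).continuousAt.comp hM
    refine hc.eventually_ne ?_
    have hone : (Matrix.of fun j k => fderiv ℝ Y (x₀, 0) (Pi.single k 1, 0) 0 j :
        Matrix (Fin d) (Fin d) ℝ) = 1 := by
      ext j k
      have h1 : HasFDerivAt (fun x : Coord d => Y (x, 0))
          ((fderiv ℝ Y (x₀, 0)).comp (ContinuousLinearMap.inl ℝ (Coord d) (Coord d))) x₀ :=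
        (hdiff _ (mem_of_mem_nhds hb)).hasFDerivAt.comp x₀ (hasFDerivAt_prodMk_left x₀ 0)
      have h2 : (fun x : Coord d => Y (x, 0)) =ᶠ[𝓝 x₀] fun x => constPath x := by
        have hc : Continuous fun x : Coord d => (x, (0 : Coord d)) := by fun_prop
        filter_upwards [hc.continuousAt.eventually (Metric.isOpen_ball.eventually_mem
          (mem_of_mem_nhds hb))] with x hx
        exact eq_of_pathDefect_zero_momentum hπ.smooth (hsol _ hx)
      have h3 := h1.unique
        ((constPath (E := Coord d)).hasFDerivAt.congr_of_eventuallyEq h2)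
      have h4 := congrArg (fun L : Coord d →L[ℝ] C(I, Coord d) => L (Pi.single k 1) 0 j) h3
      change fderiv ℝ Y (x₀, 0) (Pi.single k 1, 0) 0 j = (Pi.single k 1 : Coord d) j at h4
      rw [Matrix.of_apply, h4, Pi.single_apply, Matrix.one_apply]
    rw [hone, Matrix.det_one]
    exact one_ne_zero
  filter_upwards [hαY.eventually_nhds, hSt.eventually hdet,
    hSt.eventually (Metric.isOpen_ball.eventually_mem (mem_of_mem_nhds hb))] with z hz hzdet hzb
  have key := endpoint_bracket hπ (hdiff _ hzb)
    (by filter_upwards [Metric.isOpen_ball.eventually_mem hzb] with v' hv' using hsol _ hv') hzdet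
  have hder : ∀ (τ : I) (f : Coord d × Coord d → ℝ),
      f =ᶠ[𝓝 z] (fun z => H (Y (S z) τ)) → ∀ ξ θ,
      dirDeriv (ξ, θ) f z =
        ∑ j, differential H (Y (S z) τ) j * fderiv ℝ Y (S z) (ξ, ε • θ) τ j := by
    intro τ f hf ξ θ
    have h1 : HasFDerivAt S ((ContinuousLinearMap.fst ℝ (Coord d) (Coord d)).prod
        (ε • ContinuousLinearMap.snd ℝ (Coord d) (Coord d))) z :=
      hasFDerivAt_fst.prodMk (hasFDerivAt_snd.const_smul ε)
    have h2 : HasFDerivAt (fun z => Y (S z)) _ z := (hdiff _ hzb).hasFDerivAt.comp z h1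
    have h3 : HasFDerivAt (fun z => Y (S z) τ) _ z :=
      (ContinuousMap.evalCLM (M := Coord d) ℝ τ).hasFDerivAt.comp z h2
    have h4 : HasFDerivAt (fun z => H (Y (S z) τ)) _ z :=
      (hH.differentiable (by simp) (Y (S z) τ)).hasFDerivAt.comp z h3
    have h5 := (h4.congr_of_eventuallyEq hf).fderiv
    have h6 := congrArg (fun L : Coord d × Coord d →L[ℝ] ℝ => L (ξ, θ)) h5
    refine h6.trans ?_
    rw [← fderiv_apply_eq_sum]
    rfl
  have ha := hder 0 (fun z => H (α ε z.1 z.2)) (by filter_upwards [hz] with z' hz'; rw [hz'.1])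
  have hb := hder 1 (fun z => H (α ε z.1 (-z.2))) (by filter_upwards [hz] with z' hz'; rw [hz'.2])
  have hlin : ∀ k τ j, fderiv ℝ Y (S z) (0, ε • Pi.single k 1) τ j =
      ε * fderiv ℝ Y (S z) (0, Pi.single k 1) τ j := by
    intro k τ j
    have : ((0 : Coord d), ε • (Pi.single k 1 : Coord d)) = ε • ((0 : Coord d), Pi.single k 1) := by
      simp
    rw [this, map_smul]
    rfl
  simp only [canonicalBracket, ha, hb, smul_zero, hlin]
  set h := differential H (Y (S z) 0)
  set g := differential H (Y (S z) 1)
  set W0 := (Matrix.of fun j k => fderiv ℝ Y (S z) (Pi.single k 1, 0) 0 j :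
    Matrix (Fin d) (Fin d) ℝ) with hW0
  set Z1 := (Matrix.of fun j k => fderiv ℝ Y (S z) (0, Pi.single k 1) 1 j :
    Matrix (Fin d) (Fin d) ℝ) with hZ1
  set Z0 := (Matrix.of fun j k => fderiv ℝ Y (S z) (0, Pi.single k 1) 0 j :
    Matrix (Fin d) (Fin d) ℝ) with hZ0
  set W1 := (Matrix.of fun j k => fderiv ℝ Y (S z) (Pi.single k 1, 0) 1 j :
    Matrix (Fin d) (Fin d) ℝ) with hW1
  have e1 : (h ᵥ* W0) ⬝ᵥ (g ᵥ* Z1) = (h ᵥ* Z0) ⬝ᵥ (g ᵥ* W1) := by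
    rw [← Matrix.mulVec_transpose Z1, ← Matrix.mulVec_transpose W1, Matrix.dotProduct_mulVec,
      Matrix.dotProduct_mulVec, Matrix.vecMul_vecMul, Matrix.vecMul_vecMul, key]
  have e2 : ∀ k, ∑ j, g j * (ε * fderiv ℝ Y (S z) (0, Pi.single k 1) 1 j) =
      ε * (g ᵥ* Z1) k := fun k => by
    simp only [Matrix.vecMul, dotProduct, Finset.mul_sum, hZ1, Matrix.of_apply]
    exact Finset.sum_congr rfl fun j _ => by ring
  have e3 : ∀ k, ∑ j, h j * (ε * fderiv ℝ Y (S z) (0, Pi.single k 1) 0 j) =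
      ε * (h ᵥ* Z0) k := fun k => by
    simp only [Matrix.vecMul, dotProduct, Finset.mul_sum, hZ0, Matrix.of_apply]
    exact Finset.sum_congr rfl fun j _ => by ring
  have e4 : ∀ k, ∑ j, h j * fderiv ℝ Y (S z) (Pi.single k 1, 0) 0 j = (h ᵥ* W0) k := fun _ => rfl
  have e5 : ∀ k, ∑ j, g j * fderiv ℝ Y (S z) (Pi.single k 1, 0) 1 j = (g ᵥ* W1) k := fun _ => rfl
  simp only [e2, e3, e4, e5]
  calc _ = ε * ((h ᵥ* W0) ⬝ᵥ (g ᵥ* Z1) - (h ᵥ* Z0) ⬝ᵥ (g ᵥ* W1)) := by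
        simp only [dotProduct, ← Finset.sum_sub_distrib, Finset.mul_sum]
        exact Finset.sum_congr rfl fun k _ => by ring
    _ = 0 := by rw [e1, sub_self, mul_zero]

end Bracket

/-! ### Maps close to the identity on a ball -/

section NearIdentity

variable {E : Type} [NormedAddCommGroup E] [NormedSpace ℝ E]

/-- A smooth map which is close to the identity on a ball is a diffeomorphism of the ball onto an
open set, which contains a smaller ball. -/
theorem diffeo_of_near_id [CompleteSpace E] {g : E → E} (hg : ContDiff ℝ ∞ g) {R : ℝ}
    (hD : ∀ x ∈ Metric.ball (0 : E) R, ‖fderiv ℝ g x - ContinuousLinearMap.id ℝ E‖ < 1 / 2)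
    (hg0 : ∀ x ∈ Metric.ball (0 : E) R, ‖g x - x‖ < 1 / 2) :
    IsOpen (g '' Metric.ball 0 R) ∧
      (∃ s : E → E, ContDiffOn ℝ ∞ s (g '' Metric.ball 0 R) ∧
        ∀ x ∈ Metric.ball (0 : E) R, s (g x) = x) ∧
      Metric.closedBall 0 (R - 2) ⊆ g '' Metric.ball 0 R := by
  have happ : ApproximatesLinearOn g
      ((ContinuousLinearEquiv.refl ℝ E : E ≃L[ℝ] E) : E →L[ℝ] E) (Metric.ball 0 R) (1 / 2) := by
    intro x hx y hy
    have := (convex_ball (0 : E) R).norm_image_sub_le_of_norm_hasFDerivWithin_le'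
      (f := g) (f' := fderiv ℝ g) (φ := ContinuousLinearMap.id ℝ E) (C := 1 / 2)
      (fun z _ => (hg.differentiable (by simp) z).hasFDerivAt.hasFDerivWithinAt)
      (fun z hz => (hD z hz).le) hy hx
    simpa using! this
  have hc : Subsingleton E ∨ (1 / 2 : NNReal) <
      ‖((ContinuousLinearEquiv.refl ℝ E : E ≃L[ℝ] E).symm : E →L[ℝ] E)‖₊⁻¹ := by
    rcases subsingleton_or_nontrivial E with h | h
    · exact Or.inl h
    · right
      have : ‖((ContinuousLinearEquiv.refl ℝ E : E ≃L[ℝ] E).symm : E →L[ℝ] E)‖₊ = 1 :=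
        NNReal.eq ContinuousLinearMap.norm_id
      rw [this, inv_one]
      exact NNReal.half_lt_self one_ne_zero
  let Ψ := happ.toOpenPartialHomeomorph g (Metric.ball 0 R) hc Metric.isOpen_ball
  have htar : Ψ.target = g '' Metric.ball 0 R := rfl
  refine ⟨htar ▸ Ψ.open_target, ⟨Ψ.symm, ?_, fun x hx => Ψ.left_inv hx⟩, ?_⟩
  · intro y hy
    have hmem : Ψ.symm y ∈ Metric.ball (0 : E) R := Ψ.map_target hy
    have hlt : ‖(1 : E →L[ℝ] E) - fderiv ℝ g (Ψ.symm y)‖ < 1 := by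
      rw [norm_sub_rev]
      exact (hD _ hmem).trans (by norm_num)
    let e := ContinuousLinearEquiv.unitsEquiv ℝ E (Units.oneSub _ hlt)
    have he : (e : E →L[ℝ] E) = fderiv ℝ g (Ψ.symm y) := by
      ext1 x
      change ((Units.oneSub _ hlt : (E →L[ℝ] E)ˣ) : E →L[ℝ] E) x = _
      rw [Units.val_oneSub, sub_sub_cancel]
    have h1 : HasFDerivAt Ψ (e : E →L[ℝ] E) (Ψ.symm y) := by
      rw [he]
      exact (hg.differentiable (by simp) _).hasFDerivAt
    exact (Ψ.contDiffAt_symm hy h1 hg.contDiffAt).contDiffWithinAt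
  · intro y hy
    rw [mem_closedBall_zero_iff] at hy
    have hsub : Metric.closedBall y 1 ⊆ Metric.ball (0 : E) R := by
      intro x hx
      rw [mem_closedBall_iff_norm] at hx
      rw [mem_ball_zero_iff]
      have := norm_le_norm_sub_add x y
      linarith
    -- The image of the unit ball about y contains the ball of radius (1 - 1/2) · 1 about g y, and y
    -- lies in it because ‖g y - y‖ < 1/2. The 2 in R - 2 keeps the unit ball inside the domain.
    have hsurj := happ.surjOn_closedBall_of_nonlinearRightInverse
      ⟨id, 1, fun _ => by simp, fun _ => rfl⟩ zero_le_one hsub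
    have hmem : y ∈ Metric.closedBall (g y) ((((1 : NNReal) : ℝ)⁻¹ - ((1 / 2 : NNReal) : ℝ)) * 1) := by
      rw [mem_closedBall_iff_norm, norm_sub_rev]
      have := hg0 y (hsub (Metric.mem_closedBall_self zero_le_one))
      refine this.le.trans ?_
      norm_num
    obtain ⟨x, hx, hxy⟩ := hsurj hmem
    exact ⟨x, hsub hx, hxy⟩

/-- Both estimates hold at μ = 0 and are open conditions in (μ, x); compactness of the closed ball
makes them uniform in x. -/
theorem eventually_near_id [ProperSpace E] {P : Type} [NormedAddCommGroup P] [NormedSpace ℝ P]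
    {f : P × E → E} (hf : ContDiff ℝ ∞ f) (h0 : ∀ x, f (0, x) = x) (R : ℝ) :
    ∀ᶠ μ in 𝓝 (0 : P), ∀ x ∈ Metric.closedBall (0 : E) R,
      ‖fderiv ℝ (fun y => f (μ, y)) x - ContinuousLinearMap.id ℝ E‖ < 1 / 2 ∧
        ‖f (μ, x) - x‖ < 1 / 2 := by
  have hfd : ∀ μ x, fderiv ℝ (fun y => f (μ, y)) x =
      (fderiv ℝ f (μ, x)).comp (ContinuousLinearMap.inr ℝ P E) := fun μ x =>
    ((hf.differentiable (by simp) (μ, x)).hasFDerivAt.comp x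
      (hasFDerivAt_prodMk_right μ x)).fderiv
  refine (isCompact_closedBall (0 : E) R).eventually_forall_of_forall_eventually fun x _ => ?_
  have hid : fderiv ℝ (fun y => f (0, y)) x = ContinuousLinearMap.id ℝ E := by
    simp only [h0]
    exact fderiv_fun_id
  refine Filter.Eventually.and ?_ ?_
  · simp only [hfd]
    have hc : Continuous fun z : P × E =>
        ‖(fderiv ℝ f (z.1, z.2)).comp (ContinuousLinearMap.inr ℝ P E)
          - ContinuousLinearMap.id ℝ E‖ :=
      (((hf.continuous_fderiv (by simp)).clm_comp continuous_const).sub continuous_const).norm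
    refine hc.continuousAt.eventually_lt continuousAt_const ?_
    simp [← hfd, hid]
  · have hc : Continuous fun z : P × E => ‖f (z.1, z.2) - z.2‖ :=
      (hf.continuous.sub continuous_snd).norm
    refine hc.continuousAt.eventually_lt continuousAt_const ?_
    simp [h0]

end NearIdentity

/-! ### Definedness and reflection symmetry of the integrator -/

section Integrator

variable {d : ℕ} {π : Coord d → Matrix (Fin d) (Fin d) ℝ} {U : Set (ℝ × Coord d × Coord d)}
  {α : ℝ → Coord d → Coord d → Coord d} {H : Coord d → ℝ}

theorem IsKarasevMap.smoothAtSection (hα : IsKarasevMap π U α) (hH : ContDiff ℝ ∞ H) :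
    SmoothAtSection α H := fun ε x =>
  hH.contDiffAt.comp (ε, x, 0)
    (hα.smooth.contDiffAt (hα.isOpen.mem_nhds (hα.section_mem ε x)))

theorem betaHat_eq (n : ℕ) (ε : ℝ) (z : Coord d × Coord d) :
    betaHat α n ε z = alphaHat α n ε (z.1, -z.2) := rfl

theorem alphaHat_neg (n : ℕ) (ε : ℝ) (z : Coord d × Coord d) :
    alphaHat α n ε z = betaHat α n ε (z.1, -z.2) := by
  rw [betaHat_eq]
  simp

/-- The truncation in ε uses α only near ε = 0, where U contains every (x, p); hence it is smooth
everywhere, although α need not be. -/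
theorem IsKarasevMap.contDiff_alphaHat (hα : IsKarasevMap π U α) (n : ℕ) :
    ContDiff ℝ ∞ (fun w : ℝ × (Coord d × Coord d) => alphaHat α n w.1 w.2) := by
  have hs : SmoothAtZero (fun w : ℝ × (Coord d × Coord d) => α w.1 w.2.1 w.2.2) := fun z =>
    hα.smooth.contDiffAt (hα.isOpen.mem_nhds (hα.zero_mem z.1 z.2))
  unfold alphaHat truncation
  refine ContDiff.sum fun k _ => ?_
  have h1 : ContDiff ℝ ∞ (fun w : ℝ × (Coord d × Coord d) => w.1 ^ k / (k.factorial : ℝ)) := by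
    fun_prop
  exact h1.smul ((contDiff_jet hs k).comp contDiff_snd)

/-- The average over an interval of length zero is the initial value, so α_0(x, p) = x: the starting
point of the near-identity estimates. -/
theorem IsKarasevMap.alphaHat_zero (hα : IsKarasevMap π U α) (n : ℕ) (z : Coord d × Coord d) :
    alphaHat α n 0 z = z.1 := by
  unfold alphaHat truncation
  rw [Finset.sum_range_succ']
  obtain ⟨γ, -, -, h⟩ := hα.relation 0 z.1 z.2 (hα.zero_mem z.1 z.2)
  simp at h
  simp [← h]

/-- For small `ε` and `h`, a smooth family `a_ε` with `a_0(x, p) = x` restricts to a diffeomorphism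
of `graph(dŜ_{ε,h})` over a ball. -/
theorem IsKarasevMap.exists_isDiffeoOnto (hα : IsKarasevMap π U α) (hH : ContDiff ℝ ∞ H)
    {c : ℝ → ℝ → ℝ} (hc : ∀ ε, ContDiff ℝ ∞ (c ε)) (m : ℕ) (R : ℝ)
    (a : ℝ → Coord d × Coord d → Coord d)
    (ha : ContDiff ℝ ∞ (fun w : ℝ × (Coord d × Coord d) => a w.1 w.2))
    (ha0 : ∀ z, a 0 z = z.1) :
    ∃ δ > 0, ∀ ε h : ℝ, |ε| < δ → |h| < δ →
      IsDiffeoOnto (a ε) (lagr α H c m (Metric.ball 0 R) ε h) ∧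
      Metric.closedBall 0 (R - 2) ⊆ a ε '' lagr α H c m (Metric.ball 0 R) ε h := by
  have hs := hα.smoothAtSection hH
  have hdS : ContDiff ℝ ∞ (fun z : (ℝ × ℝ) × Coord d =>
      differential (hjTrunc α H z.1.2 0 m z.1.1) z.2) :=
    contDiff_iff_contDiffAt.2 fun z =>
      contDiffAt_differential (contDiff_hjTrunc hs m).contDiffAt
  -- Taken with c = 0, as c_ε is not assumed smooth in ε; `himg` brings c back.
  let f : (ℝ × ℝ) × Coord d → Coord d := fun z =>
    a z.1.2 (z.2, differential (hjTrunc α H z.1.2 0 m z.1.1) z.2)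
  have hf : ContDiff ℝ ∞ f :=
    ha.comp (f := fun z : (ℝ × ℝ) × Coord d =>
      (z.1.2, z.2, differential (hjTrunc α H z.1.2 0 m z.1.1) z.2))
      (ContDiff.prodMk (by fun_prop) (ContDiff.prodMk (by fun_prop) hdS))
  have hf0 : ∀ x, f (0, x) = x := fun x => ha0 _
  obtain ⟨δ, hδ, hball⟩ := Metric.eventually_nhds_iff_ball.1 (eventually_near_id hf hf0 R)
  refine ⟨δ, hδ, fun ε h hε hh => ?_⟩
  have hmem : ((h, ε) : ℝ × ℝ) ∈ Metric.ball (0 : ℝ × ℝ) δ := by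
    rw [mem_ball_zero_iff, Prod.norm_def]
    exact max_lt hh hε
  have hnear := hball _ hmem
  have hg : ContDiff ℝ ∞ (fun x => f ((h, ε), x)) := hf.comp (by fun_prop)
  obtain ⟨hopen, ⟨s, hs1, hs2⟩, hsub⟩ := diffeo_of_near_id hg (R := R)
    (fun x hx => (hnear x (Metric.ball_subset_closedBall hx)).1)
    (fun x hx => (hnear x (Metric.ball_subset_closedBall hx)).2)
  have himg : a ε '' lagr α H c m (Metric.ball 0 R) ε h =
      (fun x => f ((h, ε), x)) '' Metric.ball 0 R := by
    rw [lagr, graphD, Set.image_image]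
    refine Set.image_congr fun x _ => ?_
    rw [differential_hjTrunc hs ε (hc ε)]
  rw [himg]
  refine ⟨⟨ha.comp (f := fun z : Coord d × Coord d => (ε, z)) (by fun_prop), himg ▸ hopen,
    fun y => (s y, differential (hjTrunc α H ε 0 m h) (s y)), ?_, ?_⟩, hsub⟩
  · rw [himg]
    have h1 : ContDiff ℝ ∞ (fun x => differential (hjTrunc α H ε 0 m h) x) :=
      hdS.comp (f := fun x : Coord d => ((h, ε), x)) (by fun_prop)
    exact hs1.prodMk (h1.comp_contDiffOn hs1)
  · rintro _ ⟨x, hx, rfl⟩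
    have h2 : s (a ε (x, differential (hjTrunc α H ε 0 m h) x)) = x := hs2 x hx
    simp only [differential_hjTrunc hs ε (hc ε), h2]

/-- For small `ε` and `h` the integrator is defined on a given compact set. -/
theorem IsKarasevMap.exists_isLocalBisection (hα : IsKarasevMap π U α) (hH : ContDiff ℝ ∞ H)
    {c : ℝ → ℝ → ℝ} (hc : ∀ ε, ContDiff ℝ ∞ (c ε)) (n m : ℕ) {K : Set (Coord d)}
    (hK : IsCompact K) :
    ∃ W : Set (Coord d), IsOpen W ∧ K ⊆ W ∧ ∃ δ > 0, ∀ ε h : ℝ, |ε| < δ → |h| < δ →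
      IsLocalBisection (alphaHat α n ε) (betaHat α n ε) (lagr α H c m W ε h) ∧
      K ⊆ khjDomain α H c n m W ε h := by
  obtain ⟨r, hr⟩ := hK.isBounded.subset_closedBall (0 : Coord d)
  have hbeta : ContDiff ℝ ∞ (fun w : ℝ × (Coord d × Coord d) => betaHat α n w.1 w.2) :=
    (hα.contDiff_alphaHat n).comp
      (f := fun w : ℝ × (Coord d × Coord d) => (w.1, w.2.1, -w.2.2)) (by fun_prop)
  -- Radius r + 2, since the image is only known to contain the ball with radius smaller by 2.
  obtain ⟨δ₁, hδ₁, h₁⟩ := hα.exists_isDiffeoOnto hH hc m (r + 2) (alphaHat α n)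
    (hα.contDiff_alphaHat n) (hα.alphaHat_zero n)
  obtain ⟨δ₂, hδ₂, h₂⟩ := hα.exists_isDiffeoOnto hH hc m (r + 2) (betaHat α n)
    hbeta (fun z => hα.alphaHat_zero n (z.1, -z.2))
  refine ⟨Metric.ball 0 (r + 2), Metric.isOpen_ball,
    hr.trans (Metric.closedBall_subset_ball (by linarith)), min δ₁ δ₂, lt_min hδ₁ hδ₂,
    fun ε h hε hh => ?_⟩
  have e₁ := h₁ ε h (hε.trans_le (min_le_left _ _)) (hh.trans_le (min_le_left _ _))
  have e₂ := h₂ ε h (hε.trans_le (min_le_right _ _)) (hh.trans_le (min_le_right _ _))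
  refine ⟨⟨e₁.1, e₂.1⟩, ?_⟩
  have := e₂.2
  rw [add_sub_cancel_right] at this
  exact hr.trans this

/-- The reflection `(x, p) ↦ (x, -p)`. -/
def reflect (z : Coord d × Coord d) : Coord d × Coord d := (z.1, -z.2)

theorem IsDiffeoOnto.injOn {f : Coord d × Coord d → Coord d} {L : Set (Coord d × Coord d)}
    (h : IsDiffeoOnto f L) : Set.InjOn f L := by
  obtain ⟨-, -, s, -, hs⟩ := h
  intro z hz z' hz' e
  rw [← hs z hz, e, hs z' hz']

theorem IsDiffeoOnto.reflect {f g : Coord d × Coord d → Coord d} {L : Set (Coord d × Coord d)}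
    (h : IsDiffeoOnto f L) (hg : ContDiff ℝ ∞ g) (hfg : ∀ z, g (reflect z) = f z) :
    IsDiffeoOnto g (KHJ.reflect '' L) := by
  obtain ⟨-, hopen, s, hs1, hs2⟩ := h
  have himg : g '' (KHJ.reflect '' L) = f '' L := by
    rw [Set.image_image]
    exact Set.image_congr fun z _ => hfg z
  refine ⟨hg, himg ▸ hopen, fun y => KHJ.reflect (s y), ?_, ?_⟩
  · rw [himg]
    exact hs1.fst.prodMk hs1.snd.neg
  · rintro _ ⟨z, hz, rfl⟩
    simp only [hfg, hs2 z hz]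

theorem inducedMap_apply {a b : Coord d × Coord d → Coord d} {L : Set (Coord d × Coord d)}
    (hb : Set.InjOn b L) {z : Coord d × Coord d} (hz : z ∈ L) : inducedMap a b L (b z) = a z := by
  rw [inducedMap, hb.leftInvOn_invFunOn hz]

/-- The maps induced by `L` and by its reflection are mutually inverse. -/
theorem reflect_selfAdjoint {a b : Coord d × Coord d → Coord d} {L : Set (Coord d × Coord d)}
    (hba : ∀ z, b (reflect z) = a z) (hab : ∀ z, a (reflect z) = b z)
    (h : IsLocalBisection a b L) :
    IsLocalBisection a b (reflect '' L) ∧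
      (∀ z ∈ L, inducedMap a b (reflect '' L) (a z) = b z ∧ inducedMap a b L (b z) = a z) ∧
      b '' (reflect '' L) = a '' L ∧ a '' (reflect '' L) = b '' L := by
  have hrefl : IsLocalBisection a b (reflect '' L) :=
    ⟨h.2.reflect h.1.1 hab, h.1.reflect h.2.1 hba⟩
  refine ⟨hrefl, fun z hz => ⟨?_, inducedMap_apply h.2.injOn hz⟩, ?_, ?_⟩
  · rw [← hba z, inducedMap_apply hrefl.2.injOn (Set.mem_image_of_mem _ hz), hab]
  · rw [Set.image_image]
    exact Set.image_congr fun z _ => hba z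
  · rw [Set.image_image]
    exact Set.image_congr fun z _ => hab z

theorem lagr_neg (hπ : IsPoissonTensor π) (hα : IsKarasevMap π U α) (hH : ContDiff ℝ ∞ H)
    {c : ℝ → ℝ → ℝ} (hc : ∀ ε, ContDiff ℝ ∞ (c ε)) (m : ℕ) (W : Set (Coord d)) (ε h : ℝ) :
    lagr α H c m W ε (-h) = reflect '' lagr α H c m W ε h := by
  rw [lagr, lagr, graphD, graphD, Set.image_image]
  refine Set.image_congr fun x _ => ?_
  rw [differential_hjTrunc_neg (hα.smoothAtSection hH) ε
    (hα.canonicalBracket_eq_zero hπ hH ε) (hc ε)]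
  rfl

end Integrator

end KHJ

/-! ### The main theorem -/

theorem mainTheorem4 (d : ℕ) (π : KHJ.Coord d → Matrix (Fin d) (Fin d) ℝ)
    (hπ : KHJ.IsPoissonTensor π) (H : KHJ.Coord d → ℝ) (hH : ContDiff ℝ ∞ H) :
    -- the Karasev map exists
    (∃ U α, KHJ.IsKarasevMap π U α) ∧
    ∀ U α, KHJ.IsKarasevMap π U α →
    ∀ c : ℝ → ℝ → ℝ, (∀ ε, ContDiff ℝ ∞ (c ε)) → ∀ n m : ℕ,
      -- `Ŝ` is the order `m` Taylor truncation of every exact Hamilton-Jacobi solution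
      (∀ ε N S, KHJ.IsHJSolution U α H ε (c ε) N S → ∀ h x,
        KHJ.hjTrunc α H ε (c ε) m h x =
          ∑ l ∈ Finset.range (m + 1),
            h ^ l / (l.factorial : ℝ) * iteratedDeriv l (fun t => S t x) 0) ∧
      -- for small `ε`, `h` the integrator is well defined on a given compact set
      (∀ K : Set (KHJ.Coord d), IsCompact K →
        ∃ W : Set (KHJ.Coord d), IsOpen W ∧ K ⊆ W ∧ ∃ δ > 0, ∀ ε h : ℝ, |ε| < δ → |h| < δ →
          KHJ.IsLocalBisection (KHJ.alphaHat α n ε) (KHJ.betaHat α n ε)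
            (KHJ.lagr α H c m W ε h) ∧
          K ⊆ KHJ.khjDomain α H c n m W ε h) ∧
      -- self-adjointness wherever the integrator is defined by a local bisection
      (∀ (W : Set (KHJ.Coord d)) (ε h : ℝ), IsOpen W →
        KHJ.IsLocalBisection (KHJ.alphaHat α n ε) (KHJ.betaHat α n ε)
          (KHJ.lagr α H c m W ε h) →
        KHJ.IsLocalBisection (KHJ.alphaHat α n ε) (KHJ.betaHat α n ε)
          (KHJ.lagr α H c m W ε (-h)) ∧
        Set.BijOn (KHJ.khjMap α H c n m W ε (-h))
          (KHJ.khjDomain α H c n m W ε (-h)) (KHJ.khjDomain α H c n m W ε h) ∧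
        Set.EqOn
          (KHJ.adjointMethod (KHJ.khjMap α H c n m W ε) (KHJ.khjDomain α H c n m W ε) h)
          (KHJ.khjMap α H c n m W ε h) (KHJ.khjDomain α H c n m W ε h)) ∧
      -- self-adjointness as diffeomorphisms of `ℝ^d` in the case of a global bisection
      (∀ ε h : ℝ,
        KHJ.IsBisection (KHJ.alphaHat α n ε) (KHJ.betaHat α n ε)
          (KHJ.lagr α H c m Set.univ ε h) →
        KHJ.IsBisection (KHJ.alphaHat α n ε) (KHJ.betaHat α n ε)
          (KHJ.lagr α H c m Set.univ ε (-h)) ∧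
        Function.Bijective (KHJ.khjMap α H c n m Set.univ ε (-h)) ∧
        Function.LeftInverse (KHJ.khjMap α H c n m Set.univ ε h)
          (KHJ.khjMap α H c n m Set.univ ε (-h)) ∧
        Function.RightInverse (KHJ.khjMap α H c n m Set.univ ε h)
          (KHJ.khjMap α H c n m Set.univ ε (-h))) := by
  refine ⟨KHJ.exists_isKarasevMap hπ.smooth, fun U α hα c hc n m => ⟨fun ε N S hS h x =>
    KHJ.hjTrunc_eq_taylor (hα.smoothAtSection hH) (hc ε) hS m h x,
    fun K hK => hα.exists_isLocalBisection hH hc n m hK, ?_, ?_⟩⟩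
  · intro W ε h _ hL
    obtain ⟨hbis, hmap, hbimg, -⟩ := KHJ.reflect_selfAdjoint
      (fun z => (KHJ.alphaHat_neg n ε z).symm) (fun z => (KHJ.betaHat_eq n ε z).symm) hL
    have hneg := KHJ.lagr_neg hπ hα hH hc m W ε h
    -- The domain for -h is α̂(L), with L the Lagrangian at h, and the map for -h sends α̂ z to β̂
    -- z.
    have hbij : Set.BijOn (KHJ.khjMap α H c n m W ε (-h))
        (KHJ.khjDomain α H c n m W ε (-h)) (KHJ.khjDomain α H c n m W ε h) := by
      rw [KHJ.khjMap, KHJ.khjDomain, KHJ.khjDomain, hneg, hbimg]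
      refine ⟨?_, ?_, ?_⟩
      · rintro _ ⟨z, hz, rfl⟩
        exact ⟨z, hz, (hmap z hz).1.symm⟩
      · rintro _ ⟨z, hz, rfl⟩ _ ⟨z', hz', rfl⟩ e
        simp only [(hmap z hz).1, (hmap z' hz').1] at e
        rw [hL.2.injOn hz hz' e]
      · rintro _ ⟨z, hz, rfl⟩
        exact ⟨_, ⟨z, hz, rfl⟩, (hmap z hz).1⟩
    refine ⟨hneg ▸ hbis, hbij, ?_⟩
    rintro _ ⟨z, hz, rfl⟩
    have hmem : KHJ.alphaHat α n ε z ∈ KHJ.khjDomain α H c n m W ε (-h) := by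
      rw [KHJ.khjDomain, hneg, hbimg]
      exact ⟨z, hz, rfl⟩
    have h1 : KHJ.khjMap α H c n m W ε (-h) (KHJ.alphaHat α n ε z) = KHJ.betaHat α n ε z := by
      rw [KHJ.khjMap, hneg]
      exact (hmap z hz).1
    have h2 : KHJ.khjMap α H c n m W ε h (KHJ.betaHat α n ε z) = KHJ.alphaHat α n ε z :=
      (hmap z hz).2
    -- Injectivity forces the preimage of β̂ z chosen by `Function.invFunOn` to be α̂ z.
    rw [h2, KHJ.adjointMethod, ← h1]
    exact hbij.injOn.leftInvOn_invFunOn hmem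
  · rintro ε h ⟨hL, ha, hb⟩
    obtain ⟨hbis, hmap, hbimg, haimg⟩ := KHJ.reflect_selfAdjoint
      (fun z => (KHJ.alphaHat_neg n ε z).symm) (fun z => (KHJ.betaHat_eq n ε z).symm) hL
    have hneg := KHJ.lagr_neg hπ hα hH hc m Set.univ ε h
    have hl : Function.LeftInverse (KHJ.khjMap α H c n m Set.univ ε h)
        (KHJ.khjMap α H c n m Set.univ ε (-h)) := by
      intro x
      obtain ⟨z, hz, rfl⟩ : x ∈ KHJ.alphaHat α n ε '' KHJ.lagr α H c m Set.univ ε h := by simp [ha]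
      rw [KHJ.khjMap, KHJ.khjMap, hneg, (hmap z hz).1, (hmap z hz).2]
    have hr : Function.RightInverse (KHJ.khjMap α H c n m Set.univ ε h)
        (KHJ.khjMap α H c n m Set.univ ε (-h)) := by
      intro x
      obtain ⟨z, hz, rfl⟩ : x ∈ KHJ.betaHat α n ε '' KHJ.lagr α H c m Set.univ ε h := by simp [hb]
      rw [KHJ.khjMap, KHJ.khjMap, hneg, (hmap z hz).2, (hmap z hz).1]
    refine ⟨?_, ⟨hl.injective, hr.surjective⟩, hl, hr⟩
    rw [hneg]
    exact ⟨hbis, haimg.trans hb, hbimg.trans ha⟩
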